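/- **Setting.** Fix a set $\mathsf{AP}$ of atomic propositions and a further proposition $\mathsf{turn}\notin\mathsf{AP}$. An MDP $G$ has a finite state set $S=S_1\sqcup S_P$ (Player-1 and probabilistic states), a finite set $A$ of actions, non-empty sets $\mathsf{Av}(s)\subseteq A$ of available actions for $s\in S_1$, transition functions $\delta_1:S_1\times A\to S$ and $\delta_P:S_P\to\mathcal D(S)$ (probability distributions on $S$), a labeling $\mathcal L:S\to 2^{\mathsf{AP}}$ and an initial state. Put $\widehat{\mathcal L}(s)=\mathcal L(s)\cup\{\mathsf{turn}\}$ for $s\in S_1$ and $\widehat{\mathcal L}(s)=\mathcal L(s)$ for $s\in S_P$. A strategy $\sigma$ of Player 1 chooses, from the finite history of states and actions ending in a Player-1 state, an available action; it determines for each state $s$ a probability measure $\mathrm{Pr}^\sigma_s$ on plays from $s$. QCTL formulas are $$\psi ::= q\mid\neg q\mid\psi\vee\psi\mid\psi\wedge\psi\mid Q(\bigcirc\psi)\mid Q(\psi\,\mathcal U\,\psi)\mid Q(\psi\,\mathcal W\,\psi),$$ with $q\in\mathsf{AP}\cup\{\mathsf{turn}\}$ and $Q\in\{\langle\mathsf{Almost}\rangle,\langle\mathsf{Positive}\rangle\}$.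 Here $s\models q$ iff $q\in\widehat{\mathcal L}(s)$; $s\models\langle\mathsf{Almost}\rangle(\varphi)$ (resp. $\langle\mathsf{Positive}\rangle(\varphi)$) iff some strategy $\sigma$ has $\mathrm{Pr}^\sigma_s(\varphi)=1$ (resp. $>0$); the temporal operators next, until and weak until have their usual meaning, with $\psi_1\mathcal W\psi_2\equiv(\psi_1\mathcal U\psi_2)\vee\Box\psi_1$. Let $s\preccurlyeq_Q s'$ mean that every QCTL formula true at the state $s$ of $G$ is true at the state $s'$ of $G'$. The two-player interpretation $\widehat G$ is the game on $S$ with labeling $\widehat{\mathcal L}$ in which at $s\in S_1$ Player 1 chooses $a\in\widehat{\mathsf{Av}}(s)=\mathsf{Av}(s)$ and $\widehat\delta(s,a)=\{\delta_1(s,a)\}$, and at $s\in S_P$ the only available action is a new action $\bot$, and $\widehat\delta(s,\bot)=\mathrm{Supp}(\delta_P(s))$, from which Player 2 chooses the successor. C-ATL has the same syntax with the path quantifiers $\langle\!\langle 1\rangle\!\rangle$ (some strategy of Player 1 ensures the path formula against all strategies of Player 2) and $\langle\!\langle 1,2\rangle\!\rangle$ (some pair of strategies achieves it). Let $s\preccurlyeq_C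 s'$ mean that every C-ATL formula true at the state $s$ of $\widehat G$ is true at the state $s'$ of $\widehat G'$. A relation $\mathcal C\subseteq S\times S'$ is a combined simulation from $\widehat G$ to $\widehat G'$ if for all $(s,s')\in\mathcal C$: (1) $\widehat{\mathcal L}(s)=\widehat{\mathcal L}'(s')$; (2) for all $a\in\widehat{\mathsf{Av}}(s)$ and $t\in\widehat\delta(s,a)$ there are $a'\in\widehat{\mathsf{Av}}'(s')$ and $t'\in\widehat\delta'(s',a')$ with $(t,t')\in\mathcal C$; (3) for all $a\in\widehat{\mathsf{Av}}(s)$ there is $a'\in\widehat{\mathsf{Av}}'(s')$ such that for all $t'\in\widehat\delta'(s',a')$ there is $t\in\widehat\delta(s,a)$ with $(t,t')\in\mathcal C$. Let $\mathcal C_{\max}$ be the largest combined simulation, i.e. the union of all of them. **Theorem.** For all MDPs $G$ and $G'$, as relations between the states of $G$ and those of $G'$, $$\preccurlyeq_Q\;=\;\mathcal C_{\max}(\widehat G,\widehat G')\qquad\text{and}\qquad\preccurlyeq_Q\;=\;\preccurlyeq_C .$$ -/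

import Mathlib

open MeasureTheory ProbabilityTheory

universe u v w

/-! ### Branching-time formulas -/

/-- State formulas, in positive normal form, of a branching-time logic with path quantifiers `PQ`
and atomic propositions `P`: every temporal operator is immediately preceded by a path
quantifier. The constants true and false are `q ∨ ¬q` and `q ∧ ¬q`. -/
inductive BranchingFormula (PQ : Type) (P : Type u) : Type u
  | atom (q : P)
  | negAtom (q : P)
  | or (ψ₁ ψ₂ : BranchingFormula PQ P)
  | and (ψ₁ ψ₂ : BranchingFormula PQ P)
  | next (Q : PQ) (ψ : BranchingFormula PQ P)
  | until (Q : PQ) (ψ₁ ψ₂ : BranchingFormula PQ P)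
  | weakUntil (Q : PQ) (ψ₁ ψ₂ : BranchingFormula PQ P)

/-- The state sequences satisfying `◯ X`. -/
def pathNext {S : Type v} (X : Set S) : Set (ℕ → S) :=
  {ω | ω 1 ∈ X}

/-- The state sequences satisfying `X U Y`. -/
def pathUntil {S : Type v} (X Y : Set S) : Set (ℕ → S) :=
  {ω | ∃ j, ω j ∈ Y ∧ ∀ i < j, ω i ∈ X}

/-- The state sequences satisfying `X W Y`, that is, `(X U Y) ∨ □ X`. -/
def pathWeakUntil {S : Type v} (X Y : Set S) : Set (ℕ → S) :=
  pathUntil X Y ∪ {ω | ∀ i, ω i ∈ X}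

/-- The set `⟦ψ⟧` of states satisfying `ψ`, given the labelling of the states and the meaning of
the path quantifiers: `quant Q Φ` is the set of states at which the path quantifier `Q` holds of
the set `Φ` of state sequences. -/
def BranchingFormula.sem {PQ : Type} {P : Type u} {S : Type v} (label : S → Set P)
    (quant : PQ → Set (ℕ → S) → Set S) : BranchingFormula PQ P → Set S
  | .atom q => {s | q ∈ label s}
  | .negAtom q => {s | q ∉ label s}
  | .or ψ₁ ψ₂ => ψ₁.sem label quant ∪ ψ₂.sem label quant
  | .and ψ₁ ψ₂ => ψ₁.sem label quant ∩ ψ₂.sem label quant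
  | .next Q ψ => quant Q (pathNext (ψ.sem label quant))
  | .until Q ψ₁ ψ₂ => quant Q (pathUntil (ψ₁.sem label quant) (ψ₂.sem label quant))
  | .weakUntil Q ψ₁ ψ₂ => quant Q (pathWeakUntil (ψ₁.sem label quant) (ψ₂.sem label quant))

/-! ### Two-player games -/

/-- A two-player game with atomic propositions `P`. The value `δ s a` matters only for
actions `a` that are available in `s`. -/
structure Game (P : Type u) where
  S : Type v
  A : Type v
  finite_S : Finite S
  finite_A : Finite A
  Av : S → Set A
  Av_nonempty : ∀ s, (Av s).Nonempty
  δ : S → A → Set S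
  δ_nonempty : ∀ s, ∀ a ∈ Av s, (δ s a).Nonempty
  label : S → Set P
  init : S

namespace Game

variable {P : Type u}

/-- A Player-1 strategy: it sees the history of state-action pairs and the current state, and
chooses an available action. -/
structure Strategy₁ (G : Game.{u, v} P) where
  act : List (G.S × G.A) → G.S → G.A
  act_mem : ∀ h s, act h s ∈ G.Av s

/-- A Player-2 strategy: it sees the history, the current state and the action just chosen, and
chooses a successor state. -/
structure Strategy₂ (G : Game.{u, v} P) where
  succ : List (G.S × G.A) → G.S → G.A → G.S
  succ_mem : ∀ h s, ∀ a ∈ G.Av s, succ h s a ∈ G.δ s a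

/-- The history (oldest entry first) and the current state after `n` rounds from `s`. -/
def position (G : Game.{u, v} P) (σ : G.Strategy₁) (θ : G.Strategy₂) (s : G.S) :
    ℕ → List (G.S × G.A) × G.S
  | 0 => ([], s)
  | n + 1 =>
    let h := (position G σ θ s n).1
    let t := (position G σ θ s n).2
    (h ++ [(t, σ.act h t)], θ.succ h t (σ.act h t))

/-- The state sequence of the unique play from `s` consistent with `σ` and `θ`. -/
def play (G : Game.{u, v} P) (σ : G.Strategy₁) (θ : G.Strategy₂) (s : G.S) : ℕ → G.S :=
  fun n => (G.position σ θ s n).2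

/-- A combined simulation from `G` to `G'`. -/
structure IsCombinedSimulation (G : Game.{u, v} P) (G' : Game.{u, w} P)
    (C : G.S → G'.S → Prop) : Prop where
  label_eq : ∀ s s', C s s' → G.label s = G'.label s'
  simulation : ∀ s s', C s s' → ∀ a ∈ G.Av s, ∀ t ∈ G.δ s a,
    ∃ a' ∈ G'.Av s', ∃ t' ∈ G'.δ s' a', C t t'
  alternating : ∀ s s', C s s' → ∀ a ∈ G.Av s,
    ∃ a' ∈ G'.Av s', ∀ t' ∈ G'.δ s' a', ∃ t ∈ G.δ s a, C t t'

/-- The largest combined simulation: the union of all combined simulations. -/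
def combinedSimulation (G : Game.{u, v} P) (G' : Game.{u, w} P) (s : G.S) (s' : G'.S) : Prop :=
  ∃ C : G.S → G'.S → Prop, IsCombinedSimulation G G' C ∧ C s s'

end Game

/-- The path quantifiers `⟪1⟫` and `⟪1,2⟫` of C-ATL. -/
inductive CATLQuantifier : Type
  | one
  | oneTwo

/-- C-ATL: the fragment of ATL with path quantifiers `⟪1⟫` and `⟪1,2⟫`. -/
abbrev CATL (P : Type u) : Type u := BranchingFormula CATLQuantifier P

namespace Game

variable {P : Type u}

/-- The meaning of the path quantifiers of C-ATL. -/
def quant (G : Game.{u, v} P) : CATLQuantifier → Set (ℕ → G.S) → Set G.S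
  | .one, Φ => {s | ∃ σ : G.Strategy₁, ∀ θ : G.Strategy₂, G.play σ θ s ∈ Φ}
  | .oneTwo, Φ => {s | ∃ σ : G.Strategy₁, ∃ θ : G.Strategy₂, G.play σ θ s ∈ Φ}

/-- `s ⊨ ψ` for a state `s` of a two-player game and a C-ATL formula `ψ`. -/
def Sat (G : Game.{u, v} P) (s : G.S) (ψ : CATL P) : Prop :=
  s ∈ ψ.sem G.label G.quant

/-- The logical preorder induced by C-ATL. -/
def catlPreorder (G : Game.{u, v} P) (G' : Game.{u, w} P) (s : G.S) (s' : G'.S) : Prop :=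
  ∀ ψ : CATL P, G.Sat s ψ → G'.Sat s' ψ

end Game

/-! ### Markov decision processes -/

/-- A Markov decision process with atomic propositions `AP`; its state space is the disjoint
union of the Player-1 states `S₁` and the probabilistic states `SP`. -/
structure MDP (AP : Type u) where
  S₁ : Type v
  SP : Type v
  A : Type v
  finite_S₁ : Finite S₁
  finite_SP : Finite SP
  finite_A : Finite A
  Av : S₁ → Set A
  Av_nonempty : ∀ s, (Av s).Nonempty
  δ₁ : S₁ → A → S₁ ⊕ SP
  δP : SP → PMF (S₁ ⊕ SP)
  label : S₁ ⊕ SP → Set AP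
  init : S₁ ⊕ SP

namespace MDP

variable {AP : Type u}

/-- The states of an MDP. -/
def State (G : MDP.{u, v} AP) : Type v := G.S₁ ⊕ G.SP

instance (G : MDP.{u, v} AP) : Finite G.State :=
  haveI := G.finite_S₁
  haveI := G.finite_SP
  inferInstanceAs (Finite (G.S₁ ⊕ G.SP))

instance (G : MDP.{u, v} AP) : MeasurableSpace G.State := ⊤

instance (G : MDP.{u, v} AP) : DiscreteMeasurableSpace G.State := ⟨fun _ => trivial⟩

/-- The labelling over the propositions `AP ∪ {turn}`, where `turn`, which is true exactly at
the Player-1 states, is represented by `none`. -/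
def labelTurn (G : MDP.{u, v} AP) : G.State → Set (Option AP)
  | .inl s => some '' G.label (.inl s) ∪ {none}
  | .inr s => some '' G.label (.inr s)

/-- The two-player interpretation of an MDP; the additional action `⊥` is `none`. -/
def twoPlayer (G : MDP.{u, v} AP) : Game.{u, v} (Option AP) where
  S := G.State
  A := Option G.A
  finite_S := inferInstance
  finite_A := haveI := G.finite_A; inferInstance
  Av
    | .inl s => some '' G.Av s
    | .inr _ => {none}
  Av_nonempty
    | .inl s => (G.Av_nonempty s).image some
    | .inr _ => Set.singleton_nonempty none
  δ
    | .inl s, some a => {G.δ₁ s a}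
    | .inl _, none => ∅
    | .inr s, none => (G.δP s).support
    | .inr _, some _ => ∅
  δ_nonempty := by
    rintro (s | s) a ha
    · obtain ⟨b, _, rfl⟩ := ha
      exact Set.singleton_nonempty _
    · obtain rfl : a = none := ha
      exact (G.δP s).support_nonempty
  label := G.labelTurn
  init := G.init

/-- A Player-1 strategy: it sees the history of state-action pairs (with no action, `none`, at
probabilistic states) and the current Player-1 state, and chooses an available action. -/
structure Strategy (G : MDP.{u, v} AP) where
  act : List (G.State × Option G.A) → G.S₁ → G.A
  act_mem : ∀ h s, act h s ∈ G.Av s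

namespace Strategy

variable {G : MDP.{u, v} AP}

/-- The action played in a given state after a given history. -/
def action (σ : G.Strategy) (h : List (G.State × Option G.A)) : G.State → Option G.A
  | .inl s => some (σ.act h s)
  | .inr _ => none

/-- The distribution of the next state. -/
noncomputable def nextState (σ : G.Strategy) (h : List (G.State × Option G.A)) :
    G.State → PMF G.State
  | .inl s => PMF.pure (G.δ₁ s (σ.act h s))
  | .inr s => G.δP s

/-- The history of the first `n` rounds (oldest entry first) when the states visited are
`x 0, x 1, …` and Player 1 follows `σ`. -/
def history (σ : G.Strategy) (x : ℕ → G.State) : ℕ → List (G.State × Option G.A)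
  | 0 => []
  | n + 1 => history σ x n ++ [(x n, σ.action (history σ x n) (x n))]

/-- The random choice of the state number `n + 1`, given the states `x 0, …, x n`. -/
noncomputable def kernel (σ : G.Strategy) (n : ℕ) :
    Kernel (Finset.Iic n → G.State) G.State :=
  Kernel.ofFunOfCountable fun x =>
    (σ.nextState (σ.history (fun i => x ⟨min i n, by simp⟩) n) (x ⟨n, by simp⟩)).toMeasure

instance (σ : G.Strategy) (n : ℕ) : IsMarkovKernel (σ.kernel n) :=
  ⟨fun x => PMF.toMeasure.isProbabilityMeasure
    (σ.nextState (σ.history (fun i => x ⟨min i n, by simp⟩) n) (x ⟨n, by simp⟩))⟩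

/-- The probability measure `Pr` on the plays (state sequences) from `s` when Player 1 follows
`σ`. -/
noncomputable def pr (σ : G.Strategy) (s : G.State) : Measure (ℕ → G.State) :=
  Kernel.traj (X := fun _ => G.State) σ.kernel 0 fun _ => s

end Strategy

end MDP

/-- The path quantifiers `⟨Almost⟩` and `⟨Positive⟩` of QCTL. -/
inductive QCTLQuantifier : Type
  | almost
  | positive

/-- QCTL over the atomic propositions `AP ∪ {turn}`, with `turn` represented by `none`. -/
abbrev QCTL (AP : Type u) : Type u := BranchingFormula QCTLQuantifier (Option AP)

namespace MDP

variable {AP : Type u}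

/-- The meaning of the path quantifiers of QCTL. -/
def quant (G : MDP.{u, v} AP) : QCTLQuantifier → Set (ℕ → G.State) → Set G.State
  | .almost, Φ => {s | ∃ σ : G.Strategy, σ.pr s Φ = 1}
  | .positive, Φ => {s | ∃ σ : G.Strategy, 0 < σ.pr s Φ}

/-- `s ⊨ ψ` for a state `s` of an MDP and a QCTL formula `ψ`. -/
def Sat (G : MDP.{u, v} AP) (s : G.State) (ψ : QCTL AP) : Prop :=
  s ∈ ψ.sem G.labelTurn G.quant

/-- The logical preorder induced by QCTL. -/
def qctlPreorder (G : MDP.{u, v} AP) (G' : MDP.{u, w} AP) (s : G.State) (s' : G'.State) : Prop :=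
  ∀ ψ : QCTL AP, G.Sat s ψ → G'.Sat s' ψ

end MDP

/-! Both logics speak about two monotone operators on sets of states of the two-player game:
`controlPre` (Player 1 forces the next state) and `existsPre` (both players cooperate). A next-step
has probability one, or positive probability, according to the support of the move alone. So the two
next-operators of QCTL and those of C-ATL both denote exactly these two operators.

Each logical preorder is a combined simulation by a Hennessy–Milner argument
(`Game.isCombinedSimulation_of_next`): over finite state spaces, finite conjunctions and
disjunctions give characteristic formulas, and prefixing them with the two next-operators yields the
simulation and alternating clauses.

Conversely, the clauses say that both operators carry sets related by `Transfers` to sets related in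
the same way, and unions, intersections, least and greatest fixed points keep this. It remains to
write every quantified until and weak until as a nested fixed point of the two operators. For C-ATL
this is the usual solution of reachability and safety games. For QCTL, almost-sure weak until and
positive until look the same; `quant_almost_until` and `quant_positive_weakUntil` need nesting, and
rest on extremal arguments: on a finite set of states an average that equals its bound does so at
every successor. No exact probability enters the fixed points, so both preorders equal the largest
combined simulation. -/

/-! ### Fixed points and relations between sets -/

/-- Every state related by `C` to a member of `X` is a member of `X'`. -/
def Transfers {S : Type v} {S' : Type w} (C : S → S' → Prop) (X : Set S) (X' : Set S') : Prop :=
  ∀ s s', C s s' → s ∈ X → s' ∈ X'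

namespace Transfers

variable {S : Type v} {S' : Type w} {C : S → S' → Prop}

theorem union {X Y : Set S} {X' Y' : Set S'} (hX : Transfers C X X') (hY : Transfers C Y Y') :
    Transfers C (X ∪ Y) (X' ∪ Y') :=
  fun s s' h => Or.imp (hX s s' h) (hY s s' h)

theorem inter {X Y : Set S} {X' Y' : Set S'} (hX : Transfers C X X') (hY : Transfers C Y Y') :
    Transfers C (X ∩ Y) (X' ∩ Y') :=
  fun s s' h => And.imp (hX s s' h) (hY s s' h)

/-- The states all of whose `C`-partners lie in `F'.lfp` form a pre-fixed point of `F`. Dually, for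
greatest fixed points, the `C`-image of `F.gfp` is a post-fixed point of `F'`. -/
theorem lfp {F : Set S →o Set S} {F' : Set S' →o Set S'}
    (h : ∀ Z Z', Transfers C Z Z' → Transfers C (F Z) (F' Z')) :
    Transfers C F.lfp F'.lfp := by
  have : F.lfp ≤ {s | ∀ s', C s s' → s' ∈ F'.lfp} := by
    refine F.lfp_le fun s hs s' hC => ?_
    rw [← F'.map_lfp]
    exact h _ _ (fun t t' ht (hZ : ∀ s', C t s' → s' ∈ F'.lfp) => hZ t' ht) s s' hC hs
  exact fun s s' hC hs => this hs s' hC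

theorem gfp {F : Set S →o Set S} {F' : Set S' →o Set S'}
    (h : ∀ Z Z', Transfers C Z Z' → Transfers C (F Z) (F' Z')) :
    Transfers C F.gfp F'.gfp := by
  have : {s' | ∃ s, C s s' ∧ s ∈ F.gfp} ≤ F'.gfp := by
    refine F'.le_gfp fun s' ⟨s, hC, hs⟩ => ?_
    rw [← F.map_gfp] at hs
    exact h F.gfp {s' | ∃ s, C s s' ∧ s ∈ F.gfp} (fun t t' ht hZ => ⟨t, ht, hZ⟩) s s' hC hs
  exact fun s s' hC hs => this ⟨s, hC, hs⟩

end Transfers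

/-- The map `Z ↦ Y ∪ (X ∩ pre Z)`, whose fixed points describe `X U Y` and `X W Y`. -/
def untilMap {S : Type v} (pre : Set S →o Set S) (X Y : Set S) : Set S →o Set S where
  toFun Z := Y ∪ (X ∩ pre Z)
  monotone' _ _ h := Set.union_subset_union_right _ (Set.inter_subset_inter_right _ (pre.mono h))

theorem mem_untilMap {S : Type v} {pre : Set S →o Set S} {X Y Z : Set S} {s : S} :
    s ∈ untilMap pre X Y Z ↔ s ∈ Y ∨ s ∈ X ∧ s ∈ pre Z :=
  Iff.rfl

theorem Transfers.untilMap {S : Type v} {S' : Type w} {C : S → S' → Prop}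
    {pre : Set S →o Set S} {pre' : Set S' →o Set S'} {X Y Z : Set S} {X' Y' Z' : Set S'}
    (hpre : ∀ Z Z', Transfers C Z Z' → Transfers C (pre Z) (pre' Z'))
    (hX : Transfers C X X') (hY : Transfers C Y Y') (hZ : Transfers C Z Z') :
    Transfers C (untilMap pre X Y Z) (untilMap pre' X' Y' Z') :=
  hY.union (hX.inter (hpre _ _ hZ))

/-- The members of the least fixed point of a monotone map on a finite type can be ranked so that
membership is justified by members of smaller rank. -/
theorem OrderHom.exists_rank_lfp {S : Type v} [Finite S] (F : Set S →o Set S) :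
    ∃ r : S → ℕ, ∀ s ∈ F.lfp, s ∈ F {t | t ∈ F.lfp ∧ r t < r s} := by
  classical
  have hsub : ∀ n, F^[n] ∅ ⊆ F.lfp := by
    intro n
    induction n with
    | zero => exact Set.empty_subset _
    | succ n ih =>
      rw [Function.iterate_succ_apply', ← F.map_lfp]
      exact F.mono ih
  have hmono : Monotone fun n => F^[n] ∅ := F.mono.monotone_iterate_of_le_map (Set.empty_subset _)
  obtain ⟨N, hN⟩ := WellFoundedGT.monotone_chain_condition (⟨_, hmono⟩ : ℕ →o Set S)
  have hlfp : F.lfp ⊆ F^[N] ∅ := by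
    refine F.lfp_le ?_
    rw [← Function.iterate_succ_apply' F]
    exact (hN (N + 1) N.le_succ).ge
  -- The rank is the first iterate containing the state. Keeping membership as a premise under the
  -- quantifier makes the rank total, with junk value 0 outside the fixed point.
  have hex : ∀ s, ∃ n, s ∈ F.lfp → s ∈ F^[n] ∅ := fun s => ⟨N, fun h => hlfp h⟩
  refine ⟨fun s => Nat.find (hex s), fun s hs => ?_⟩
  have hmem := Nat.find_spec (hex s) hs
  rcases hn : Nat.find (hex s) with _ | n
  · rw [hn] at hmem
    exact hmem.elim
  · rw [hn, Function.iterate_succ_apply'] at hmem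
    have hle : F^[n] ∅ ≤ {t | t ∈ F.lfp ∧ Nat.find (hex t) < n + 1} := fun t ht =>
      ⟨hsub n ht, Nat.lt_succ_of_le (Nat.find_le fun _ => ht)⟩
    simpa only [hn] using F.mono hle hmem

/-! ### One-step operators of a game -/

namespace Game

variable {P : Type u}

/-- The states at which Player 1 can force the next state to be in `Z`. -/
def controlPre (G : Game.{u, v} P) : Set G.S →o Set G.S where
  toFun Z := {s | ∃ a ∈ G.Av s, ∀ t ∈ G.δ s a, t ∈ Z}
  monotone' _ _ h _ := fun ⟨a, ha, H⟩ => ⟨a, ha, fun t ht => h (H t ht)⟩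

/-- The states at which the two players together can bring about a next state in `Z`. -/
def existsPre (G : Game.{u, v} P) : Set G.S →o Set G.S where
  toFun Z := {s | ∃ a ∈ G.Av s, ∃ t ∈ G.δ s a, t ∈ Z}
  monotone' _ _ h _ := fun ⟨a, ha, t, ht, H⟩ => ⟨a, ha, t, ht, h H⟩

variable {G : Game.{u, v} P} {G' : Game.{u, w} P} {C : G.S → G'.S → Prop}

theorem IsCombinedSimulation.transfers_controlPre (hC : IsCombinedSimulation G G' C)
    (Z : Set G.S) (Z' : Set G'.S) (h : Transfers C Z Z') :
    Transfers C (G.controlPre Z) (G'.controlPre Z') := by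
  rintro s s' hs ⟨a, ha, H⟩
  obtain ⟨a', ha', H'⟩ := hC.alternating s s' hs a ha
  refine ⟨a', ha', fun t' ht' => ?_⟩
  obtain ⟨t, ht, htt⟩ := H' t' ht'
  exact h t t' htt (H t ht)

theorem IsCombinedSimulation.transfers_existsPre (hC : IsCombinedSimulation G G' C)
    (Z : Set G.S) (Z' : Set G'.S) (h : Transfers C Z Z') :
    Transfers C (G.existsPre Z) (G'.existsPre Z') := by
  rintro s s' hs ⟨a, ha, t, ht, H⟩
  obtain ⟨a', ha', t', ht', htt⟩ := hC.simulation s s' hs a ha t ht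
  exact ⟨a', ha', t', ht', h t t' htt H⟩

end Game

/-! ### Preservation and characterisation by formulas -/

theorem BranchingFormula.transfers_sem {PQ : Type} {P : Type u} {S : Type v} {S' : Type w}
    {C : S → S' → Prop} {label : S → Set P} {label' : S' → Set P}
    {quant : PQ → Set (ℕ → S) → Set S} {quant' : PQ → Set (ℕ → S') → Set S'}
    (hlabel : ∀ s s', C s s' → label s = label' s')
    (hnext : ∀ Q X X', Transfers C X X' →
      Transfers C (quant Q (pathNext X)) (quant' Q (pathNext X')))
    (huntil : ∀ Q X Y X' Y', Transfers C X X' → Transfers C Y Y' →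
      Transfers C (quant Q (pathUntil X Y)) (quant' Q (pathUntil X' Y')))
    (hweak : ∀ Q X Y X' Y', Transfers C X X' → Transfers C Y Y' →
      Transfers C (quant Q (pathWeakUntil X Y)) (quant' Q (pathWeakUntil X' Y')))
    (ψ : BranchingFormula PQ P) : Transfers C (ψ.sem label quant) (ψ.sem label' quant') :=
  match ψ with
  | .atom _ => fun s s' h hs => (hlabel s s' h).subset hs
  | .negAtom _ => fun s s' h hs hs' => hs ((hlabel s s' h).symm.subset hs')
  | .or ψ₁ ψ₂ => (transfers_sem hlabel hnext huntil hweak ψ₁)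
      |>.union (transfers_sem hlabel hnext huntil hweak ψ₂)
  | .and ψ₁ ψ₂ => (transfers_sem hlabel hnext huntil hweak ψ₁)
      |>.inter (transfers_sem hlabel hnext huntil hweak ψ₂)
  | .next Q ψ => hnext Q _ _
      (transfers_sem hlabel hnext huntil hweak ψ)
  | .until Q ψ₁ ψ₂ => huntil Q _ _ _ _
      (transfers_sem hlabel hnext huntil hweak ψ₁)
      (transfers_sem hlabel hnext huntil hweak ψ₂)
  | .weakUntil Q ψ₁ ψ₂ => hweak Q _ _ _ _
      (transfers_sem hlabel hnext huntil hweak ψ₁)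
      (transfers_sem hlabel hnext huntil hweak ψ₂)

namespace BranchingFormula

variable {PQ : Type} {P : Type u} {S : Type v} {S' : Type w}
  {label : S → Set P} {label' : S' → Set P}
  {quant : PQ → Set (ℕ → S) → Set S} {quant' : PQ → Set (ℕ → S') → Set S'}

/-- A formula true at `t` that holds only at states above `t` in the logical preorder. -/
theorem exists_characteristic [Nonempty P] [Finite S'] (t : S) :
    ∃ ψ : BranchingFormula PQ P, t ∈ ψ.sem label quant ∧ ∀ t' ∈ ψ.sem label' quant',
      ∀ χ : BranchingFormula PQ P, t ∈ χ.sem label quant → t' ∈ χ.sem label' quant' := by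
  suffices H : ∀ T : Set S', ∃ ψ : BranchingFormula PQ P, t ∈ ψ.sem label quant ∧
      ∀ t' ∈ T, t' ∈ ψ.sem label' quant' →
        ∀ χ : BranchingFormula PQ P, t ∈ χ.sem label quant → t' ∈ χ.sem label' quant' by
    obtain ⟨ψ, h, h'⟩ := H Set.univ
    exact ⟨ψ, h, fun t' => h' t' trivial⟩
  intro T
  induction T, T.toFinite using Set.Finite.induction_on with
  | empty =>
    obtain ⟨q⟩ := ‹Nonempty P›
    exact ⟨.or (.atom q) (.negAtom q), em _, fun _ h => h.elim⟩
  | @insert a T _ _ ih =>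
    obtain ⟨ψ, hψ, ih⟩ := ih
    -- Each state of the finite set that is not above `t` costs one further conjunct, true at `t`
    -- and false there.
    by_cases ha : ∀ χ : BranchingFormula PQ P, t ∈ χ.sem label quant → a ∈ χ.sem label' quant'
    · refine ⟨ψ, hψ, ?_⟩
      rintro t' (rfl | ht')
      exacts [fun _ => ha, ih t' ht']
    · push Not at ha
      obtain ⟨χ, h₁, h₂⟩ := ha
      refine ⟨.and χ ψ, ⟨h₁, hψ⟩, ?_⟩
      rintro t' (rfl | ht') ⟨h, h'⟩
      exacts [(h₂ h).elim, ih t' ht' h']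

/-- The disjunction of the characteristic formulas of the members works; it describes all successors
under one action at once, as the alternating clause requires. -/
theorem exists_characteristic_set [Nonempty P] [Finite S'] [Finite S] (T : Set S) :
    ∃ ψ : BranchingFormula PQ P, T ⊆ ψ.sem label quant ∧ ∀ t' ∈ ψ.sem label' quant',
      ∃ t ∈ T, ∀ χ : BranchingFormula PQ P, t ∈ χ.sem label quant → t' ∈ χ.sem label' quant' := by
  induction T, T.toFinite using Set.Finite.induction_on with
  | empty =>
    obtain ⟨q⟩ := ‹Nonempty P›
    exact ⟨.and (.atom q) (.negAtom q), Set.empty_subset _, fun _ h => (h.2 h.1).elim⟩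
  | @insert a T _ _ ih =>
    obtain ⟨ψ, hψ, ih⟩ := ih
    obtain ⟨χ, hχ, hχ'⟩ := exists_characteristic (label := label) (label' := label')
      (quant := quant) (quant' := quant') a
    refine ⟨.or χ ψ, Set.insert_subset (Or.inl hχ) (hψ.trans Set.subset_union_right), ?_⟩
    rintro t' (h | h)
    · exact ⟨a, Set.mem_insert _ _, hχ' t' h⟩
    · obtain ⟨t, ht, H⟩ := ih t' h
      exact ⟨t, Set.mem_insert_of_mem _ ht, H⟩

end BranchingFormula

/-- If a logic can express the one-step operators of games, then its logical preorder is a combined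
simulation. -/
theorem Game.isCombinedSimulation_of_next {PQ : Type} {P : Type u} [Nonempty P]
    {G : Game.{u, v} P} {G' : Game.{u, w} P}
    {quant : PQ → Set (ℕ → G.S) → Set G.S} {quant' : PQ → Set (ℕ → G'.S) → Set G'.S} (A E : PQ)
    (hA : ∀ X, quant A (pathNext X) = G.controlPre X)
    (hE : ∀ X, quant E (pathNext X) = G.existsPre X)
    (hA' : ∀ X, quant' A (pathNext X) = G'.controlPre X)
    (hE' : ∀ X, quant' E (pathNext X) = G'.existsPre X) :
    IsCombinedSimulation G G' fun s s' =>
      ∀ ψ : BranchingFormula PQ P, s ∈ ψ.sem G.label quant → s' ∈ ψ.sem G'.label quant' := by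
  have := G.finite_S
  have := G'.finite_S
  refine ⟨fun s s' h => ?_, fun s s' h a ha t ht => ?_, fun s s' h a ha => ?_⟩
  · exact Set.Subset.antisymm (fun q => h (.atom q)) fun q hq => by_contra fun hq' =>
      h (.negAtom q) hq' hq
  · obtain ⟨ψ, hψ, hψ'⟩ := BranchingFormula.exists_characteristic (label := G.label)
      (label' := G'.label) (quant := quant) (quant' := quant') t
    have hs' := h (.next E ψ) ((hE _).symm.subset ⟨a, ha, t, ht, hψ⟩)
    obtain ⟨a', ha', t', ht', H⟩ := (hE' _).subset hs'
    exact ⟨a', ha', t', ht', hψ' t' H⟩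
  · obtain ⟨ψ, hψ, hψ'⟩ := BranchingFormula.exists_characteristic_set (label := G.label)
      (label' := G'.label) (quant := quant) (quant' := quant') (G.δ s a)
    have hs' := h (.next A ψ) ((hA _).symm.subset ⟨a, ha, hψ⟩)
    obtain ⟨a', ha', H⟩ := (hA' _).subset hs'
    exact ⟨a', ha', fun t' ht' => hψ' t' (H t' ht')⟩

/-! ### Path quantifiers of C-ATL as fixed points -/

namespace Game

variable {P : Type u} {G : Game.{u, v} P}

/-- The Player-1 strategy that selects an action by `f`, which ignores the history. -/
def Strategy₁.positional (f : G.S → G.A) (hf : ∀ s, f s ∈ G.Av s) : G.Strategy₁ where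
  act _ s := f s
  act_mem _ s := hf s

/-- The Player-2 strategy that selects a successor by `f`, which ignores the history. -/
def Strategy₂.positional (f : G.S → G.A → G.S) (hf : ∀ s, ∀ a ∈ G.Av s, f s a ∈ G.δ s a) :
    G.Strategy₂ where
  succ _ s a := f s a
  succ_mem _ s a ha := hf s a ha

/-- The strategy that `σ` induces after a first round `x`. -/
def Strategy₁.shift (σ : G.Strategy₁) (x : G.S × G.A) : G.Strategy₁ where
  act h s := σ.act (x :: h) s
  act_mem h s := σ.act_mem (x :: h) s

/-- The strategy that `θ` induces after a first round `x`. -/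
def Strategy₂.shift (θ : G.Strategy₂) (x : G.S × G.A) : G.Strategy₂ where
  succ h s a := θ.succ (x :: h) s a
  succ_mem h s a ha := θ.succ_mem (x :: h) s a ha

/-- The first move and the continuation can be prescribed independently, since a strategy sees
whether its history is empty. -/
theorem exists_strategy₁_shift_eq (s : G.S) {a : G.A} (ha : a ∈ G.Av s) (σ : G.Strategy₁) :
    ∃ σ' : G.Strategy₁, σ'.act [] s = a ∧ ∀ x, σ'.shift x = σ := by
  classical
  refine ⟨⟨fun h t => match h with
    | [] => if t = s then a else (G.Av_nonempty t).some
    | _ :: h => σ.act h t, fun h t => ?_⟩, if_pos rfl, fun _ => rfl⟩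
  rcases h with _ | ⟨_, h⟩
  · change (if t = s then a else _) ∈ _
    split_ifs with h
    exacts [h ▸ ha, (G.Av_nonempty t).some_mem]
  · exact σ.act_mem h t

theorem exists_strategy₂_shift_eq (s : G.S) {a : G.A} {t : G.S} (ht : t ∈ G.δ s a)
    (θ : G.Strategy₂) : ∃ θ' : G.Strategy₂, θ'.succ [] s a = t ∧ ∀ x, θ'.shift x = θ := by
  classical
  refine ⟨⟨fun h s' a' => match h with
    | [] => if s' = s ∧ a' = a then t else θ.succ [] s' a'
    | _ :: h => θ.succ h s' a', fun h s' a' ha' => ?_⟩, if_pos ⟨rfl, rfl⟩, fun _ => rfl⟩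
  rcases h with _ | ⟨_, h⟩
  · change (if s' = s ∧ a' = a then t else _) ∈ _
    split_ifs with h
    · rwa [h.1, h.2]
    · exact θ.succ_mem _ _ _ ha'
  · exact θ.succ_mem _ _ _ ha'

theorem nonempty_strategy₁ (G : Game.{u, v} P) : Nonempty G.Strategy₁ :=
  ⟨.positional (fun s => (G.Av_nonempty s).some) fun s => (G.Av_nonempty s).some_mem⟩

theorem exists_positional₁ (G : Game.{u, v} P) (p : G.S → G.A → Prop) :
    ∃ f : G.S → G.A, (∀ s, f s ∈ G.Av s) ∧ ∀ s, (∃ a ∈ G.Av s, p s a) → p s (f s) := by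
  have : ∀ s, ∃ a, a ∈ G.Av s ∧ ((∃ a ∈ G.Av s, p s a) → p s a) := fun s => by
    by_cases h : ∃ a ∈ G.Av s, p s a
    · obtain ⟨a, ha, hp⟩ := h
      exact ⟨a, ha, fun _ => hp⟩
    · obtain ⟨a, ha⟩ := G.Av_nonempty s
      exact ⟨a, ha, fun h' => (h h').elim⟩
  choose f hf using this
  exact ⟨f, fun s => (hf s).1, fun s => (hf s).2⟩

theorem exists_positional₂ (G : Game.{u, v} P) (p : G.S → G.A → G.S → Prop) :
    ∃ f : G.S → G.A → G.S, (∀ s, ∀ a ∈ G.Av s, f s a ∈ G.δ s a) ∧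
      ∀ s, ∀ a ∈ G.Av s, (∃ t ∈ G.δ s a, p s a t) → p s a (f s a) := by
  have : ∀ s a, ∃ t, a ∈ G.Av s → t ∈ G.δ s a ∧ ((∃ t ∈ G.δ s a, p s a t) → p s a t) :=
    fun s a => by
    by_cases ha : a ∈ G.Av s
    · by_cases h : ∃ t ∈ G.δ s a, p s a t
      · obtain ⟨t, ht, hp⟩ := h
        exact ⟨t, fun _ => ⟨ht, fun _ => hp⟩⟩
      · obtain ⟨t, ht⟩ := G.δ_nonempty s a ha
        exact ⟨t, fun _ => ⟨ht, fun h' => (h h').elim⟩⟩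
    · exact ⟨s, fun h => (ha h).elim⟩
  choose f hf using this
  exact ⟨f, fun s a ha => (hf s a ha).1, fun s a ha => (hf s a ha).2⟩

theorem nonempty_strategy₂ (G : Game.{u, v} P) : Nonempty G.Strategy₂ := by
  obtain ⟨f, hf, -⟩ := G.exists_positional₂ fun _ _ _ => True
  exact ⟨.positional f hf⟩

/-- The definition appends the last round; fixed-point expansions need the first round split off
instead. -/
theorem position_succ (σ : G.Strategy₁) (θ : G.Strategy₂) (s : G.S) (n : ℕ) :
    G.position σ θ s (n + 1) =
      let a := σ.act [] s
      let p := G.position (σ.shift (s, a)) (θ.shift (s, a)) (θ.succ [] s a) n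
      ((s, a) :: p.1, p.2) := by
  induction n with
  | zero => rfl
  | succ n ih =>
    rw [position, ih]
    rfl

theorem play_succ (σ : G.Strategy₁) (θ : G.Strategy₂) (s : G.S) (n : ℕ) :
    G.play σ θ s (n + 1) = G.play (σ.shift (s, σ.act [] s)) (θ.shift (s, σ.act [] s))
      (θ.succ [] s (σ.act [] s)) n := by
  rw [play, position_succ]
  rfl

theorem play_succ_mem (σ : G.Strategy₁) (θ : G.Strategy₂) (s : G.S) (n : ℕ) :
    ∃ h, G.play σ θ s (n + 1) =
      θ.succ h (G.play σ θ s n) (σ.act h (G.play σ θ s n)) :=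
  ⟨_, rfl⟩

end Game

/-! ### Expansion laws and certificates for until and weak until along a path -/

section Paths

variable {S : Type v} {X Y : Set S} {ω : ℕ → S}

theorem mem_pathUntil_iff_shift :
    ω ∈ pathUntil X Y ↔ ω 0 ∈ Y ∨ ω 0 ∈ X ∧ (fun n => ω (n + 1)) ∈ pathUntil X Y := by
  constructor
  · rintro ⟨j, hj, h⟩
    rcases j with _ | j
    · exact Or.inl hj
    · exact Or.inr ⟨h 0 j.succ_pos, j, hj, fun i hi => h (i + 1) (Nat.succ_lt_succ hi)⟩
  · rintro (h | ⟨h, j, hj, H⟩)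
    · exact ⟨0, h, fun i hi => (Nat.not_lt_zero i hi).elim⟩
    · refine ⟨j + 1, hj, fun i hi => ?_⟩
      rcases i with _ | i
      exacts [h, H i (Nat.lt_of_succ_lt_succ hi)]

theorem mem_pathWeakUntil_iff_shift :
    ω ∈ pathWeakUntil X Y ↔ ω 0 ∈ Y ∨ ω 0 ∈ X ∧ (fun n => ω (n + 1)) ∈ pathWeakUntil X Y := by
  have : (∀ i, ω i ∈ X) ↔ ω 0 ∈ X ∧ ∀ i, ω (i + 1) ∈ X :=
    ⟨fun h => ⟨h 0, fun i => h _⟩, fun h i => by rcases i with _ | i; exacts [h.1, h.2 i]⟩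
  rw [pathWeakUntil, Set.mem_union, Set.mem_union, mem_pathUntil_iff_shift]
  change _ ∨ (∀ i, ω i ∈ X) ↔ _ ∨ _ ∧ (_ ∨ ∀ i, ω (i + 1) ∈ X)
  rw [this]
  tauto

/-- A path violates `X W Y` iff it leaves `X` at a point before which, and at which, it has not
met `Y`. -/
theorem notMem_pathWeakUntil_iff :
    ω ∉ pathWeakUntil X Y ↔ ∃ n, ω n ∉ X ∧ ∀ i ≤ n, ω i ∉ Y := by
  classical
  constructor
  · intro h
    have hex : ∃ n, ω n ∉ X := by
      by_contra! hX
      exact h (Or.inr hX)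
    refine ⟨Nat.find hex, Nat.find_spec hex, fun i hi hY => h (Or.inl ⟨i, hY, fun j hj => ?_⟩)⟩
    exact not_not.1 (Nat.find_min hex (hj.trans_le hi))
  · rintro ⟨n, hX, hY⟩ (⟨j, hj, H⟩ | H)
    · rcases lt_or_ge n j with h | h
      exacts [hX (H n h), hY j h hj]
    · exact hX (H n)

/-- A path whose members outside `Y` are in `X` and are followed by members of `Z`, with decreasing
rank, satisfies `X U Y`. -/
theorem mem_pathUntil_of_rank {Z : Set S} (r : S → ℕ) (h₀ : ω 0 ∈ Z)
    (h : ∀ n, ω n ∈ Z → ω n ∈ Y ∨ ω n ∈ X ∧ ω (n + 1) ∈ Z ∧ r (ω (n + 1)) < r (ω n)) :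
    ω ∈ pathUntil X Y := by
  induction hk : r (ω 0) using Nat.strong_induction_on generalizing ω with
  | _ k ih =>
    refine mem_pathUntil_iff_shift.2 ((h 0 h₀).imp_right fun ⟨hX, hZ, hr⟩ => ⟨hX, ?_⟩)
    exact ih _ (hk ▸ hr) hZ (fun n => h (n + 1)) rfl

theorem mem_pathWeakUntil_of_invariant {Z : Set S} (h₀ : ω 0 ∈ Z)
    (h : ∀ n, ω n ∈ Z → ω n ∈ Y ∨ ω n ∈ X ∧ ω (n + 1) ∈ Z) : ω ∈ pathWeakUntil X Y := by
  by_contra hω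
  obtain ⟨n, hX, hY⟩ := notMem_pathWeakUntil_iff.1 hω
  have hZ : ∀ i ≤ n, ω i ∈ Z := by
    intro i hi
    induction i with
    | zero => exact h₀
    | succ i ih =>
      have hi' := (Nat.le_succ i).trans hi
      exact ((h i (ih hi')).resolve_left (hY i hi')).2
  exact hX ((h n (hZ n le_rfl)).resolve_left (hY n le_rfl)).1

theorem notMem_pathUntil_of_invariant {Z : Set S} (h₀ : ω 0 ∈ Z)
    (h : ∀ n, ω n ∈ Z → ω n ∉ Y ∧ (ω n ∈ X → ω (n + 1) ∈ Z)) : ω ∉ pathUntil X Y := by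
  rintro ⟨j, hj, H⟩
  have hZ : ∀ i ≤ j, ω i ∈ Z := by
    intro i hi
    induction i with
    | zero => exact h₀
    | succ i ih => exact (h i (ih ((Nat.le_succ i).trans hi))).2 (H i hi)
  exact (h j (hZ j le_rfl)).1 hj

end Paths

/-! ### Reachability and safety games -/

namespace Game

variable {P : Type u} {G : Game.{u, v} P}

theorem quant_one_next (X : Set G.S) : G.quant .one (pathNext X) = G.controlPre X := by
  ext s
  constructor
  · rintro ⟨σ, hσ⟩
    obtain ⟨θ⟩ := G.nonempty_strategy₂
    refine ⟨σ.act [] s, σ.act_mem _ _, fun t ht => ?_⟩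
    obtain ⟨θ', h, -⟩ := exists_strategy₂_shift_eq s ht θ
    exact h ▸ hσ θ'
  · rintro ⟨a, ha, H⟩
    obtain ⟨σ⟩ := G.nonempty_strategy₁
    obtain ⟨σ', rfl, -⟩ := exists_strategy₁_shift_eq s ha σ
    exact ⟨σ', fun θ => H _ (θ.succ_mem _ _ _ ha)⟩

theorem quant_oneTwo_next (X : Set G.S) : G.quant .oneTwo (pathNext X) = G.existsPre X := by
  ext s
  constructor
  · rintro ⟨σ, θ, h⟩
    exact ⟨σ.act [] s, σ.act_mem _ _, _, θ.succ_mem _ _ _ (σ.act_mem _ _), h⟩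
  · rintro ⟨a, ha, t, ht, H⟩
    obtain ⟨σ⟩ := G.nonempty_strategy₁
    obtain ⟨θ⟩ := G.nonempty_strategy₂
    obtain ⟨σ', rfl, -⟩ := exists_strategy₁_shift_eq s ha σ
    obtain ⟨θ', rfl, -⟩ := exists_strategy₂_shift_eq s ht θ
    exact ⟨σ', θ', H⟩

/-- Outside the least fixed point Player 2 can stay outside with a positional strategy, so `Y` is
not met while `X` lasts. Inside it, Player 1 plays positionally so that the rank decreases whatever
Player 2 does. -/
theorem quant_one_until (X Y : Set G.S) :
    G.quant .one (pathUntil X Y) = (untilMap G.controlPre X Y).lfp := by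
  have := G.finite_S
  set F := untilMap G.controlPre X Y
  apply Set.Subset.antisymm
  · rintro s ⟨σ, hσ⟩
    by_contra hs
    obtain ⟨f, hf, hf'⟩ := G.exists_positional₂ fun _ _ t => t ∉ F.lfp
    refine notMem_pathUntil_of_invariant (Z := (F.lfp)ᶜ) hs (fun n hn => ?_)
      (hσ (.positional f hf))
    have hn' : G.play σ (.positional f hf) s n ∉ F F.lfp := F.map_lfp.symm ▸ hn
    refine ⟨fun h => hn' (Or.inl h), fun h => ?_⟩
    obtain ⟨h', hh⟩ := play_succ_mem σ (.positional f hf) s n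
    rw [hh]
    refine hf' _ _ (σ.act_mem _ _) ?_
    by_contra! H
    exact hn' (Or.inr ⟨h, _, σ.act_mem _ _, H⟩)
  · intro s hs
    obtain ⟨r, hr⟩ := F.exists_rank_lfp
    obtain ⟨f, hf, hf'⟩ := G.exists_positional₁ fun s a =>
      ∀ t ∈ G.δ s a, t ∈ F.lfp ∧ r t < r s
    refine ⟨.positional f hf, fun θ => mem_pathUntil_of_rank (Z := F.lfp) r hs fun n hn => ?_⟩
    refine (hr _ hn).imp_right fun h => ⟨h.1, ?_⟩
    exact hf' _ h.2 _ (θ.succ_mem _ _ _ (hf _))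

/-- The winning region is a post-fixed point, by shifting the winning strategy past the first round.
Conversely, an action that stays in the greatest fixed point can be chosen positionally. -/
theorem quant_one_weakUntil (X Y : Set G.S) :
    G.quant .one (pathWeakUntil X Y) = (untilMap G.controlPre X Y).gfp := by
  set F := untilMap G.controlPre X Y
  apply Set.Subset.antisymm
  · refine F.le_gfp ?_
    rintro s ⟨σ, hσ⟩
    obtain ⟨θ⟩ := G.nonempty_strategy₂
    refine or_iff_not_imp_left.2 fun hY => ?_
    refine ⟨((mem_pathWeakUntil_iff_shift.1 (hσ θ)).resolve_left hY).1, ?_⟩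
    refine ⟨σ.act [] s, σ.act_mem _ _, fun t ht => ⟨σ.shift (s, σ.act [] s), fun θ => ?_⟩⟩
    obtain ⟨θ', rfl, hθ⟩ := exists_strategy₂_shift_eq s ht θ
    have := ((mem_pathWeakUntil_iff_shift.1 (hσ θ')).resolve_left hY).2
    simp only [play_succ, hθ] at this
    exact this
  · intro s hs
    obtain ⟨f, hf, hf'⟩ := G.exists_positional₁ fun s a => ∀ t ∈ G.δ s a, t ∈ F.gfp
    refine ⟨.positional f hf, fun θ => mem_pathWeakUntil_of_invariant (Z := F.gfp) hs
      fun n hn => ?_⟩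
    rw [← F.map_gfp] at hn
    exact hn.imp_right fun h => ⟨h.1, hf' _ h.2 _ (θ.succ_mem _ _ _ (hf _))⟩

theorem quant_oneTwo_until (X Y : Set G.S) :
    G.quant .oneTwo (pathUntil X Y) = (untilMap G.existsPre X Y).lfp := by
  set F := untilMap G.existsPre X Y
  apply Set.Subset.antisymm
  · rintro s ⟨σ, θ, hω⟩
    by_contra hs
    refine notMem_pathUntil_of_invariant (Z := (F.lfp)ᶜ) hs (fun n hn => ?_) hω
    have hn' : G.play σ θ s n ∉ F F.lfp := F.map_lfp.symm ▸ hn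
    exact ⟨fun h => hn' (Or.inl h), fun h h' => hn' (Or.inr
      ⟨h, _, σ.act_mem _ _, _, θ.succ_mem _ _ _ (σ.act_mem _ _), h'⟩)⟩
  · refine F.lfp_le ?_
    rintro s (hs | ⟨hX, a, ha, t, ht, σ, θ, hω⟩)
    · obtain ⟨σ⟩ := G.nonempty_strategy₁
      obtain ⟨θ⟩ := G.nonempty_strategy₂
      exact ⟨σ, θ, mem_pathUntil_iff_shift.2 (Or.inl hs)⟩
    · obtain ⟨σ', rfl, hσ⟩ := exists_strategy₁_shift_eq s ha σ
      obtain ⟨θ', rfl, hθ⟩ := exists_strategy₂_shift_eq s ht θ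
      refine ⟨σ', θ', mem_pathUntil_iff_shift.2 (Or.inr ⟨hX, ?_⟩)⟩
      simp only [play_succ, hθ, hσ]
      exact hω

theorem quant_oneTwo_weakUntil (X Y : Set G.S) :
    G.quant .oneTwo (pathWeakUntil X Y) = (untilMap G.existsPre X Y).gfp := by
  set F := untilMap G.existsPre X Y
  apply Set.Subset.antisymm
  · refine F.le_gfp ?_
    rintro s ⟨σ, θ, hω⟩
    refine mem_untilMap.2 ((mem_pathWeakUntil_iff_shift.1 hω).imp_right fun h => ⟨h.1, ?_⟩)
    have h' := h.2
    simp only [play_succ] at h'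
    exact ⟨σ.act [] s, σ.act_mem _ _, _, θ.succ_mem _ _ _ (σ.act_mem _ _), _, _, h'⟩
  · intro s hs
    obtain ⟨f, hf, hf'⟩ := G.exists_positional₁ fun s a => ∃ t ∈ G.δ s a, t ∈ F.gfp
    obtain ⟨g, hg, hg'⟩ := G.exists_positional₂ fun _ _ t => t ∈ F.gfp
    refine ⟨.positional f hf, .positional g hg, mem_pathWeakUntil_of_invariant (Z := F.gfp) hs
      fun n hn => ?_⟩
    rw [← F.map_gfp] at hn
    exact hn.imp_right fun h => ⟨h.1, hg' _ _ (hf _) (hf' _ h.2)⟩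

theorem catlPreorder_eq_combinedSimulation (G : Game.{u, v} P) (G' : Game.{u, w} P) [Nonempty P] :
    G.catlPreorder G' = combinedSimulation G G' := by
  funext s s'
  refine propext ⟨fun h => ⟨_, isCombinedSimulation_of_next CATLQuantifier.one .oneTwo
    quant_one_next quant_oneTwo_next quant_one_next quant_oneTwo_next, h⟩, ?_⟩
  rintro ⟨C, hC, hs⟩ ψ
  refine BranchingFormula.transfers_sem hC.label_eq ?_ ?_ ?_ ψ s s' hs
  · rintro (_ | _) X X' hX
    · simpa only [quant_one_next] using hC.transfers_controlPre X X' hX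
    · simpa only [quant_oneTwo_next] using hC.transfers_existsPre X X' hX
  · rintro (_ | _) X Y X' Y' hX hY
    · simpa only [quant_one_until] using
        .lfp fun _ _ => .untilMap hC.transfers_controlPre hX hY
    · simpa only [quant_oneTwo_until] using
        .lfp fun _ _ => .untilMap hC.transfers_existsPre hX hY
  · rintro (_ | _) X Y X' Y' hX hY
    · simpa only [quant_one_weakUntil] using
        .gfp fun _ _ => .untilMap hC.transfers_controlPre hX hY
    · simpa only [quant_oneTwo_weakUntil] using
        .gfp fun _ _ => .untilMap hC.transfers_existsPre hX hY

end Game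

/-! ### The measure on the plays of an MDP -/

namespace MDP

variable {AP : Type u} {G : MDP.{u, v} AP}

/-- Prepending a state to a state sequence. -/
def consPath {S : Type v} (s : S) (ω : ℕ → S) : ℕ → S
  | 0 => s
  | n + 1 => ω n

namespace Strategy

/-- The strategy that `σ` induces after a first round `x`. -/
def shift (σ : G.Strategy) (x : G.State × Option G.A) : G.Strategy where
  act h s := σ.act (x :: h) s
  act_mem h s := σ.act_mem (x :: h) s

theorem history_congr (σ : G.Strategy) {x y : ℕ → G.State} {n : ℕ} (h : ∀ i < n, x i = y i) :
    σ.history x n = σ.history y n := by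
  induction n with
  | zero => rfl
  | succ n ih =>
    simp only [history]
    rw [ih fun i hi => h i (Nat.lt_succ_of_lt hi), h n n.lt_succ_self]

theorem action_shift (σ : G.Strategy) (x : G.State × Option G.A)
    (h : List (G.State × Option G.A)) (s : G.State) :
    (σ.shift x).action h s = σ.action (x :: h) s := by
  rcases s with s | s <;> rfl

theorem nextState_shift (σ : G.Strategy) (x : G.State × Option G.A)
    (h : List (G.State × Option G.A)) (s : G.State) :
    (σ.shift x).nextState h s = σ.nextState (x :: h) s := by
  rcases s with s | s <;> rfl

theorem history_succ (σ : G.Strategy) (x : ℕ → G.State) (n : ℕ) :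
    σ.history x (n + 1) = (x 0, σ.action [] (x 0)) ::
      (σ.shift (x 0, σ.action [] (x 0))).history (fun i => x (i + 1)) n := by
  induction n with
  | zero => rfl
  | succ n ih =>
    rw [history, ih]
    conv_rhs => rw [history, action_shift]
    rfl

instance (σ : G.Strategy) (s : G.State) : IsProbabilityMeasure (σ.pr s) := by
  unfold pr; infer_instance

/-- The state sequences that agree with `x` up to position `n`. -/
def cyl {S : Type v} (x : ℕ → S) (n : ℕ) : Set (ℕ → S) := {ω | ∀ i ≤ n, ω i = x i}

theorem cyl_eq_preimage (x : ℕ → G.State) (n : ℕ) :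
    cyl x n = Preorder.frestrictLe (π := fun _ => G.State) n ⁻¹'
      {Preorder.frestrictLe (π := fun _ => G.State) n x} := by
  ext ω
  simp only [cyl, Set.mem_ofPred_eq, Set.mem_preimage, Set.mem_singleton_iff, funext_iff]
  exact ⟨fun h i => h i (Finset.mem_Iic.1 i.2), fun h i hi => h ⟨i, Finset.mem_Iic.2 hi⟩⟩

theorem cyl_subset_zero {S : Type v} (x : ℕ → S) (n : ℕ) : cyl x n ⊆ cyl x 0 :=
  fun _ h i hi => h i (hi.trans n.zero_le)

theorem measurableSet_cyl (x : ℕ → G.State) (n : ℕ) : MeasurableSet (cyl x n) := by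
  rw [cyl_eq_preimage]
  exact (Preorder.measurable_frestrictLe (X := fun _ => G.State) n) (measurableSet_singleton _)

theorem pr_cyl_zero (σ : G.Strategy) (s : G.State) (x : ℕ → G.State) [Decidable (s = x 0)] :
    σ.pr s (cyl x 0) = if s = x 0 then 1 else 0 := by
  rw [cyl_eq_preimage, ← Measure.map_apply (by fun_prop) (measurableSet_singleton _), pr,
    Kernel.traj_map_frestrictLe_apply, Kernel.partialTraj_self, Kernel.id_apply,
    Measure.dirac_apply' _ (measurableSet_singleton _)]
  split_ifs with h
  · refine Set.indicator_of_mem ?_ _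
    ext ⟨i, hi⟩
    obtain rfl : i = 0 := Nat.le_zero.1 (Finset.mem_Iic.1 hi)
    exact h
  · refine Set.indicator_of_notMem (fun h' => h ?_) _
    exact congrFun (Set.mem_singleton_iff.1 h') ⟨0, by simp⟩

/-- This is the disintegration of the trajectory measure into its first `n` steps and the kernel for
the next one, read on a single finite path. -/
theorem pr_cyl_succ (σ : G.Strategy) (s : G.State) (x : ℕ → G.State) (n : ℕ) :
    σ.pr s (cyl x (n + 1)) =
      σ.pr s (cyl x n) * σ.nextState (σ.history x n) (x n) (x (n + 1)) := by
  have hset : cyl x (n + 1) =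
      (fun ω : ℕ → G.State => (Preorder.frestrictLe (π := fun _ => G.State) n ω, ω (n + 1))) ⁻¹'
        ({Preorder.frestrictLe (π := fun _ => G.State) n x} ×ˢ {x (n + 1)}) := by
    ext ω
    change _ ↔ ω ∈ Preorder.frestrictLe (π := fun _ => G.State) n ⁻¹'
      {Preorder.frestrictLe (π := fun _ => G.State) n x} ∧ ω (n + 1) = x (n + 1)
    rw [← cyl_eq_preimage]
    constructor
    · exact fun h => ⟨fun i hi => h i (Nat.le_succ_of_le hi), h _ le_rfl⟩
    · rintro ⟨h, h'⟩ i hi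
      rcases Nat.le_succ_iff.1 hi with hi | rfl
      exacts [h i hi, h']
  have key := Kernel.partialTraj_compProd_eq_map_traj (X := fun _ => G.State) (κ := σ.kernel)
    (Nat.zero_le n) (x₀ := fun _ => s)
  rw [hset, ← Measure.map_apply (by fun_prop)
    ((measurableSet_singleton _).prod (measurableSet_singleton _)), pr, ← key,
    Measure.compProd_apply_prod (measurableSet_singleton _) (measurableSet_singleton _),
    lintegral_singleton, mul_comm, cyl_eq_preimage,
    ← Measure.map_apply (by fun_prop) (measurableSet_singleton _),
    Kernel.traj_map_frestrictLe_apply]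
  congr 1
  change (σ.nextState (σ.history _ n) (x n)).toMeasure {x (n + 1)} = _
  rw [PMF.toMeasure_apply_singleton _ _ (measurableSet_singleton _)]
  congr 2
  -- The kernel extends a finite path to a sequence by clamping indices at `n`; the history only
  -- looks below `n`, where clamping changes nothing.
  exact σ.history_congr fun i hi => congrArg x (min_eq_left hi.le)

/-- Conditioning on the first step. -/
theorem pr_cyl_succ' (σ : G.Strategy) (x : ℕ → G.State) (n : ℕ) :
    σ.pr (x 0) (cyl x (n + 1)) = σ.nextState [] (x 0) (x 1) *
      (σ.shift (x 0, σ.action [] (x 0))).pr (x 1) (cyl (fun i => x (i + 1)) n) := by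
  classical
  induction n with
  | zero => simp [pr_cyl_succ, pr_cyl_zero, history]
  | succ n ih =>
    rw [pr_cyl_succ, ih, pr_cyl_succ, history_succ, ← nextState_shift, mul_assoc]

/-- Cylinders give the singletons of the finite-dimensional marginals, and projective limits are
unique. Length at least one suffices because long marginals determine short ones; this is the range
where the first step can be split off. -/
theorem ext_of_cyl {μ ν : Measure (ℕ → G.State)} [IsFiniteMeasure μ]
    (h : ∀ x n, μ (cyl x (n + 1)) = ν (cyl x (n + 1))) : μ = ν := by
  have hlim : IsProjectiveLimit (α := fun _ => G.State) ν fun I => μ.map I.restrict := by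
    rw [isProjectiveLimit_nat_iff' (isProjectiveMeasureFamily_map_restrict fun t =>
      (measurable_pi_apply t).aemeasurable) _ 1]
    rintro (_ | n) hn
    · exact (Nat.not_succ_le_zero _ hn).elim
    refine Measure.ext_of_singleton fun y => ?_
    obtain ⟨x, rfl⟩ : ∃ x, Preorder.frestrictLe (π := fun _ => G.State) (n + 1) x = y :=
      ⟨fun i => y ⟨min i (n + 1), by simp⟩, by
        ext ⟨i, hi⟩
        exact congrArg y (Subtype.ext (min_eq_left (Finset.mem_Iic.1 hi)))⟩
    have h' := h x n
    rw [cyl_eq_preimage] at h'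
    rw [Measure.map_apply (by fun_prop) (measurableSet_singleton _), ← h']
    exact (Measure.map_apply (by fun_prop) (measurableSet_singleton _)).symm
  have hfin : ∀ I : Finset ℕ, IsFiniteMeasure (μ.map (I.restrict (π := fun _ => G.State))) :=
    fun I => inferInstance
  exact (hlim.unique fun I => rfl).symm

theorem measurable_consPath (s : G.State) : Measurable (consPath s) :=
  measurable_pi_lambda _ fun n => by
    rcases n with _ | n
    exacts [measurable_const, measurable_pi_apply n]

/-- The Markov property at time one: both sides are measures agreeing on cylinders, where only the
successor `x 1` contributes to the sum. -/
theorem pr_eq_sum (σ : G.Strategy) (s : G.State) {Φ : Set (ℕ → G.State)} (hΦ : MeasurableSet Φ) :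
    σ.pr s Φ = ∑' t, σ.nextState [] s t *
      (σ.shift (s, σ.action [] s)).pr t (consPath s ⁻¹' Φ) := by
  classical
  have : σ.pr s = Measure.sum fun t => σ.nextState [] s t •
      ((σ.shift (s, σ.action [] s)).pr t).map (consPath s) := by
    refine ext_of_cyl fun x n => ?_
    rw [Measure.sum_apply _ (measurableSet_cyl _ _)]
    simp only [Measure.smul_apply, smul_eq_mul,
      Measure.map_apply (measurable_consPath s) (measurableSet_cyl _ _)]
    by_cases hs : s = x 0
    · subst hs
      have hpre : consPath (x 0) ⁻¹' cyl x (n + 1) = cyl (fun i => x (i + 1)) n := by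
        ext ω
        refine ⟨fun h i hi => h (i + 1) (Nat.succ_le_succ hi), fun h i hi => ?_⟩
        rcases i with _ | i
        exacts [rfl, h i (Nat.le_of_succ_le_succ hi)]
      rw [pr_cyl_succ', hpre, tsum_eq_single (x 1)]
      intro t ht
      rw [measure_mono_null (cyl_subset_zero _ _)
        ((pr_cyl_zero _ _ _).trans (if_neg ht)), mul_zero]
    · rw [measure_mono_null (cyl_subset_zero _ _) ((pr_cyl_zero σ s x).trans (if_neg hs))]
      refine (ENNReal.tsum_eq_zero.2 fun t => ?_).symm
      rw [Set.preimage_eq_empty_iff.2, measure_empty, mul_zero]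
      exact Set.disjoint_left.2 fun ω h ⟨ω', h'⟩ =>
        hs ((congrFun h' 0).trans (h 0 (Nat.zero_le _)))
  rw [this, Measure.sum_apply _ hΦ]
  simp only [Measure.smul_apply, smul_eq_mul, Measure.map_apply (measurable_consPath s) hΦ]

end Strategy
end MDP

open scoped ENNReal

/-! ### Averages over a probability mass function -/

namespace PMF

variable {α : Type v} (p : PMF α) {f : α → ℝ≥0∞} {m : ℝ≥0∞}

theorem tsum_mul_const (m : ℝ≥0∞) : ∑' t, p t * m = m := by
  rw [ENNReal.tsum_mul_right, p.tsum_coe, one_mul]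

theorem tsum_mul_le (h : ∀ t, p t ≠ 0 → f t ≤ m) : ∑' t, p t * f t ≤ m := by
  rw [← p.tsum_mul_const m]
  refine ENNReal.tsum_le_tsum fun t => ?_
  by_cases ht : p t = 0
  · simp [ht]
  · exact mul_le_mul_right (h t ht) _

/-- A strict deficit at one point of the support would pull the average strictly below the bound.
Finiteness of `m` makes the comparison of sums strict. -/
theorem eq_of_le_tsum_mul (hm : m ≠ ∞) (h : ∀ t, p t ≠ 0 → f t ≤ m) (hs : m ≤ ∑' t, p t * f t)
    {t : α} (ht : p t ≠ 0) : f t = m := by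
  by_contra hne
  refine hs.not_gt (lt_of_lt_of_eq ?_ (p.tsum_mul_const m))
  refine ENNReal.tsum_lt_tsum ((p.tsum_mul_le h).trans_lt hm.lt_top).ne (fun u => ?_)
    ((ENNReal.mul_lt_mul_iff_right ht (p.apply_ne_top t)).2 (lt_of_le_of_ne (h t ht) hne))
  by_cases hu : p u = 0
  · simp [hu]
  · exact mul_le_mul_right (h u hu) _

theorem eq_of_tsum_mul_le (hm : m ≠ ∞) (h : ∀ t, p t ≠ 0 → m ≤ f t) (hs : ∑' t, p t * f t ≤ m)
    {t : α} (ht : p t ≠ 0) : f t = m := by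
  by_contra hne
  refine hs.not_gt (lt_of_eq_of_lt (p.tsum_mul_const m).symm ?_)
  refine ENNReal.tsum_lt_tsum (by rwa [p.tsum_mul_const m]) (fun u => ?_)
    ((ENNReal.mul_lt_mul_iff_right ht (p.apply_ne_top t)).2 (lt_of_le_of_ne (h t ht) (Ne.symm hne)))
  by_cases hu : p u = 0
  · simp [hu]
  · exact mul_le_mul_right (h u hu) _

end PMF

/-! ### Almost sure events, positional strategies and available moves -/

namespace MDP

variable {AP : Type u} {G : MDP.{u, v} AP}

namespace Strategy

theorem pr_eq_one_iff (σ : G.Strategy) (s : G.State) {Φ : Set (ℕ → G.State)}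
    (hΦ : MeasurableSet Φ) :
    σ.pr s Φ = 1 ↔ ∀ t, σ.nextState [] s t ≠ 0 →
      (σ.shift (s, σ.action [] s)).pr t (consPath s ⁻¹' Φ) = 1 := by
  rw [pr_eq_sum _ _ hΦ]
  refine ⟨fun h t => PMF.eq_of_le_tsum_mul _ ENNReal.one_ne_top (fun t _ => prob_le_one) h.ge,
    fun h => ?_⟩
  refine ((tsum_congr fun t => ?_).trans ((σ.nextState [] s).tsum_mul_const 1))
  by_cases ht : σ.nextState [] s t = 0
  · simp [ht]
  · rw [h t ht]

theorem pr_ne_zero_iff (σ : G.Strategy) (s : G.State) {Φ : Set (ℕ → G.State)}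
    (hΦ : MeasurableSet Φ) :
    σ.pr s Φ ≠ 0 ↔ ∃ t, σ.nextState [] s t ≠ 0 ∧
      (σ.shift (s, σ.action [] s)).pr t (consPath s ⁻¹' Φ) ≠ 0 := by
  rw [pr_eq_sum _ _ hΦ, Ne, ENNReal.tsum_eq_zero]
  simp only [mul_eq_zero, not_forall, not_or, ne_eq]

theorem ae_iff (σ : G.Strategy) (s : G.State) {p : (ℕ → G.State) → Prop}
    (hp : MeasurableSet {ω | p ω}) :
    (∀ᵐ ω ∂σ.pr s, p ω) ↔ ∀ t, σ.nextState [] s t ≠ 0 →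
      ∀ᵐ ω ∂(σ.shift (s, σ.action [] s)).pr t, p (consPath s ω) := by
  have h := not_congr (σ.pr_ne_zero_iff s hp.compl)
  push Not at h
  exact h

theorem ae_start (σ : G.Strategy) (s : G.State) : ∀ᵐ ω ∂σ.pr s, ω 0 = s := by
  refine (ae_iff σ s (p := fun ω => ω 0 = s) ?_).2 fun t _ => ae_of_all _ fun _ => rfl
  exact (measurable_pi_apply 0 : Measurable fun ω : ℕ → G.State => ω 0)
    (measurableSet_singleton s)

/-- Almost surely all steps of a play belong to a relation that contains all possible steps. -/
theorem ae_steps (σ : G.Strategy) (s : G.State) {R : G.State → G.State → Prop}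
    (hR : ∀ h s t, σ.nextState h s t ≠ 0 → R s t) :
    ∀ᵐ ω ∂σ.pr s, ∀ n, R (ω n) (ω (n + 1)) := by
  refine ae_all_iff.2 fun n => ?_
  have hmeas : ∀ n, MeasurableSet {ω : ℕ → G.State | R (ω n) (ω (n + 1))} := fun n =>
    (show Measurable fun ω : ℕ → G.State => (ω n, ω (n + 1)) by fun_prop)
      (MeasurableSet.of_discrete (s := {q : G.State × G.State | R q.1 q.2}))
  induction n generalizing σ s with
  | zero =>
    refine (ae_iff σ s (hmeas 0)).2 fun t ht => ?_
    filter_upwards [ae_start _ t] with ω hω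
    change R s (ω 0)
    exact hω.symm ▸ hR [] s t ht
  | succ n ih =>
    refine (ae_iff σ s (hmeas (n + 1))).2 fun t _ => ih _ t fun h s' t' ht' => ?_
    rw [nextState_shift] at ht'
    exact hR _ s' t' ht'

end Strategy

theorem nonempty_strategy (G : MDP.{u, v} AP) : Nonempty G.Strategy :=
  ⟨⟨fun _ s => (G.Av_nonempty s).some, fun _ s => (G.Av_nonempty s).some_mem⟩⟩

/-- A strategy that makes its first choice like `σ₀` and continues like `σ`. -/
def Strategy.cons (σ₀ σ : G.Strategy) : G.Strategy where
  act
    | [], s => σ₀.act [] s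
    | _ :: h, s => σ.act h s
  act_mem h s := by
    rcases h with _ | ⟨_, h⟩
    exacts [σ₀.act_mem [] s, σ.act_mem h s]

theorem Strategy.nextState_cons (σ₀ σ : G.Strategy) (s : G.State) :
    (σ₀.cons σ).nextState [] s = σ₀.nextState [] s := by
  rcases s with s | s <;> rfl

/-- A positional strategy whose moves have a property wherever some move has it. -/
theorem exists_positional (G : MDP.{u, v} AP) (p : G.State → PMF G.State → Prop) :
    ∃ σ : G.Strategy, (∀ x, σ.shift x = σ) ∧ (∀ h s, σ.nextState h s = σ.nextState [] s) ∧
      ∀ s, (∃ σ' : G.Strategy, p s (σ'.nextState [] s)) → p s (σ.nextState [] s) := by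
  have : ∀ s : G.S₁, ∃ a ∈ G.Av s, (∃ σ' : G.Strategy, p (.inl s) (σ'.nextState [] (.inl s))) →
      p (.inl s) (PMF.pure (G.δ₁ s a)) := fun s => by
    by_cases h : ∃ σ' : G.Strategy, p (.inl s) (σ'.nextState [] (.inl s))
    · obtain ⟨σ', h⟩ := h
      exact ⟨σ'.act [] s, σ'.act_mem _ _, fun _ => h⟩
    · obtain ⟨a, ha⟩ := G.Av_nonempty s
      exact ⟨a, ha, fun h' => (h h').elim⟩
  choose f hf hf' using this
  refine ⟨⟨fun _ => f, fun _ => hf⟩, fun _ => rfl, fun h s => ?_, fun s => ?_⟩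
  · rcases s with s | s <;> rfl
  · rcases s with s | s
    exacts [hf' s, fun ⟨_, h⟩ => h]

/-- Ensures that an optimal first move exists, although there may be infinitely many strategies. -/
theorem finite_range_nextState (s : G.State) :
    (Set.range fun σ : G.Strategy => σ.nextState [] s).Finite := by
  have := G.finite_A
  rcases s with s | s
  · refine (Set.finite_range fun a => (PMF.pure (G.δ₁ s a) : PMF G.State)).subset ?_
    rintro _ ⟨σ, rfl⟩
    exact ⟨σ.act [] s, rfl⟩
  · refine (Set.finite_singleton (G.δP s)).subset ?_
    rintro _ ⟨σ, rfl⟩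
    rfl

/-! ### One-step operators of an MDP -/

/-- The one-step operator of Player 1 in the two-player interpretation. -/
def controlPre (G : MDP.{u, v} AP) : Set G.State →o Set G.State := G.twoPlayer.controlPre

/-- The cooperative one-step operator in the two-player interpretation. -/
def existsPre (G : MDP.{u, v} AP) : Set G.State →o Set G.State := G.twoPlayer.existsPre

theorem exists_strategy_act_eq (s : G.S₁) {a : G.A} (ha : a ∈ G.Av s) :
    ∃ σ : G.Strategy, σ.act [] s = a := by
  classical
  refine ⟨⟨fun _ t => if t = s then a else (G.Av_nonempty t).some, fun _ t => ?_⟩, if_pos rfl⟩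
  split_ifs with h
  exacts [h ▸ ha, (G.Av_nonempty t).some_mem]

/-- The moves of the two-player interpretation are the supports of the moves of the MDP. -/
theorem exists_mem_twoPlayer_Av_iff (s : G.State) (p : Set G.State → Prop) :
    (∃ a ∈ G.twoPlayer.Av s, p (G.twoPlayer.δ s a)) ↔
      ∃ σ : G.Strategy, p (σ.nextState [] s).support := by
  rcases s with s | s
  · constructor
    · rintro ⟨_, ⟨a, ha, rfl⟩, h⟩
      obtain ⟨σ, rfl⟩ := exists_strategy_act_eq s ha
      exact ⟨σ, (PMF.support_pure (G.δ₁ s (σ.act [] s))).symm ▸ h⟩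
    · rintro ⟨σ, h⟩
      exact ⟨_, ⟨σ.act [] s, σ.act_mem _ _, rfl⟩,
        (congrArg p (PMF.support_pure (G.δ₁ s (σ.act [] s)))).mp h⟩
  · constructor
    · rintro ⟨_, rfl, h⟩
      obtain ⟨σ⟩ := G.nonempty_strategy
      exact ⟨σ, h⟩
    · rintro ⟨_, h⟩
      exact ⟨none, rfl, h⟩

theorem mem_controlPre_iff {s : G.State} {Z : Set G.State} :
    s ∈ G.controlPre Z ↔ ∃ σ : G.Strategy, ∀ t, σ.nextState [] s t ≠ 0 → t ∈ Z :=
  exists_mem_twoPlayer_Av_iff s fun T => ∀ t ∈ T, t ∈ Z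

theorem mem_existsPre_iff {s : G.State} {Z : Set G.State} :
    s ∈ G.existsPre Z ↔ ∃ σ : G.Strategy, ∃ t, σ.nextState [] s t ≠ 0 ∧ t ∈ Z :=
  exists_mem_twoPlayer_Av_iff s fun T => ∃ t ∈ T, t ∈ Z

/-- A Player-1 move has a single successor, so a move that can reach `V` surely stays in `V ⊆ Z`. A
probabilistic state has only one move, so both properties concern the same move. -/
theorem exists_strategy_of_mem_controlPre_of_mem_existsPre {s : G.State} {V Z : Set G.State}
    (hVZ : V ⊆ Z) (hc : s ∈ G.controlPre Z) (he : s ∈ G.existsPre V) :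
    ∃ σ : G.Strategy, (∀ t, σ.nextState [] s t ≠ 0 → t ∈ Z) ∧
      ∃ t, σ.nextState [] s t ≠ 0 ∧ t ∈ V := by
  obtain ⟨σ, t, ht, hV⟩ := mem_existsPre_iff.1 he
  refine ⟨σ, fun u hu => ?_, t, ht, hV⟩
  rcases s with s | s
  · have ht' := (PMF.mem_support_pure_iff (G.δ₁ s (σ.act [] s)) t).1 ht
    have hu' := (PMF.mem_support_pure_iff (G.δ₁ s (σ.act [] s)) u).1 hu
    exact hVZ ((hu'.trans ht'.symm) ▸ hV)
  · obtain ⟨_, h⟩ := mem_controlPre_iff.1 hc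
    exact h u hu

/-! ### Path quantifiers of QCTL as fixed points -/

theorem measurableSet_apply_mem (n : ℕ) (X : Set G.State) :
    MeasurableSet {ω : ℕ → G.State | ω n ∈ X} :=
  (measurable_pi_apply n : Measurable fun ω : ℕ → G.State => ω n)
    (MeasurableSet.of_discrete (s := X))

theorem pr_start (σ : G.Strategy) (s : G.State) (X : Set G.State) [Decidable (s ∈ X)] :
    σ.pr s {ω | ω 0 ∈ X} = if s ∈ X then 1 else 0 := by
  split_ifs with h
  · refine (mem_ae_iff_prob_eq_one (measurableSet_apply_mem 0 X)).1 ?_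
    filter_upwards [σ.ae_start s] with ω hω
    exact hω.symm ▸ h
  · refine measure_eq_zero_iff_ae_notMem.2 ?_
    filter_upwards [σ.ae_start s] with ω hω hX
    exact h (hω ▸ hX)

theorem quant_almost_next (X : Set G.State) :
    G.quant .almost (pathNext X) = G.controlPre X := by
  classical
  ext s
  rw [mem_controlPre_iff]
  refine exists_congr fun σ => ?_
  rw [σ.pr_eq_one_iff s (Φ := pathNext X) (measurableSet_apply_mem 1 X)]
  refine forall₂_congr fun t _ => ?_
  change Strategy.pr _ t {ω | ω 0 ∈ X} = 1 ↔ _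
  simp [pr_start]

theorem quant_positive_next (X : Set G.State) :
    G.quant .positive (pathNext X) = G.existsPre X := by
  classical
  ext s
  rw [mem_existsPre_iff]
  refine exists_congr fun σ => ?_
  rw [pos_iff_ne_zero, σ.pr_ne_zero_iff s (Φ := pathNext X) (measurableSet_apply_mem 1 X)]
  refine exists_congr fun t => and_congr_right fun _ => ?_
  change Strategy.pr _ t {ω | ω 0 ∈ X} ≠ 0 ↔ _
  simp [pr_start]

/-- The sets of state sequences, like `X U Y` and `X W Y`, that satisfy the expansion law. -/
structure IsExpansion (X Y : Set G.State) (Φ : Set (ℕ → G.State)) : Prop where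
  measurableSet : MeasurableSet Φ
  mem_iff : ∀ ω, ω ∈ Φ ↔ ω 0 ∈ Y ∨ ω 0 ∈ X ∧ (fun n => ω (n + 1)) ∈ Φ

theorem measurableSet_pathUntil (X Y : Set G.State) : MeasurableSet (pathUntil X Y) := by
  have : pathUntil X Y = ⋃ j, {ω | ω j ∈ Y} ∩ ⋂ i, ⋂ _ : i < j, {ω | ω i ∈ X} := by
    ext ω
    simp [pathUntil]
  rw [this]
  exact .iUnion fun j => (measurableSet_apply_mem j Y).inter
    (.iInter fun i => .iInter fun _ => measurableSet_apply_mem i X)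

theorem isExpansion_pathUntil (X Y : Set G.State) : IsExpansion X Y (pathUntil X Y) :=
  ⟨measurableSet_pathUntil X Y, fun _ => mem_pathUntil_iff_shift⟩

theorem isExpansion_pathWeakUntil (X Y : Set G.State) : IsExpansion X Y (pathWeakUntil X Y) := by
  refine ⟨(measurableSet_pathUntil X Y).union ?_, fun _ => mem_pathWeakUntil_iff_shift⟩
  have : {ω : ℕ → G.State | ∀ i, ω i ∈ X} = ⋂ i, {ω | ω i ∈ X} := by
    ext ω
    simp
  rw [this]
  exact .iInter fun i => measurableSet_apply_mem i X

namespace IsExpansion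

variable {X Y : Set G.State} {Φ : Set (ℕ → G.State)}

theorem pr_of_mem (hΦ : IsExpansion X Y Φ) (σ : G.Strategy) {s : G.State} (hY : s ∈ Y) :
    σ.pr s Φ = 1 := by
  refine (mem_ae_iff_prob_eq_one hΦ.measurableSet).1 ?_
  filter_upwards [σ.ae_start s] with ω hω
  exact (hΦ.mem_iff ω).2 (Or.inl (hω.symm ▸ hY))

theorem mem_of_pr_ne_zero (hΦ : IsExpansion X Y Φ) (σ : G.Strategy) {s : G.State} (hY : s ∉ Y)
    (h : σ.pr s Φ ≠ 0) : s ∈ X := by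
  by_contra hX
  refine h (measure_eq_zero_iff_ae_notMem.2 ?_)
  filter_upwards [σ.ae_start s] with ω hω hω'
  rcases (hΦ.mem_iff ω).1 hω' with h' | h'
  exacts [hY (hω ▸ h'), hX (hω ▸ h'.1)]

theorem preimage_consPath (hΦ : IsExpansion X Y Φ) {s : G.State} (hX : s ∈ X) (hY : s ∉ Y) :
    consPath s ⁻¹' Φ = Φ := by
  ext ω
  refine (hΦ.mem_iff _).trans ⟨fun h => (h.resolve_left hY).2, fun h => Or.inr ⟨hX, h⟩⟩

theorem pr_eq_sum (hΦ : IsExpansion X Y Φ) (σ : G.Strategy) {s : G.State} (hX : s ∈ X)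
    (hY : s ∉ Y) :
    σ.pr s Φ = ∑' t, σ.nextState [] s t * (σ.shift (s, σ.action [] s)).pr t Φ := by
  rw [σ.pr_eq_sum s hΦ.measurableSet, hΦ.preimage_consPath hX hY]

theorem pr_eq_one_iff (hΦ : IsExpansion X Y Φ) (σ : G.Strategy) {s : G.State} (hX : s ∈ X)
    (hY : s ∉ Y) :
    σ.pr s Φ = 1 ↔
      ∀ t, σ.nextState [] s t ≠ 0 → (σ.shift (s, σ.action [] s)).pr t Φ = 1 := by
  rw [σ.pr_eq_one_iff s hΦ.measurableSet, hΦ.preimage_consPath hX hY]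

theorem pr_ne_zero_iff (hΦ : IsExpansion X Y Φ) (σ : G.Strategy) {s : G.State} (hX : s ∈ X)
    (hY : s ∉ Y) :
    σ.pr s Φ ≠ 0 ↔
      ∃ t, σ.nextState [] s t ≠ 0 ∧ (σ.shift (s, σ.action [] s)).pr t Φ ≠ 0 := by
  rw [σ.pr_ne_zero_iff s hΦ.measurableSet, hΦ.preimage_consPath hX hY]

theorem quant_almost_subset (hΦ : IsExpansion X Y Φ) :
    G.quant .almost Φ ⊆ untilMap G.controlPre X Y (G.quant .almost Φ) := by
  rintro s ⟨σ, hσ⟩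
  refine or_iff_not_imp_left.2 fun hY => ?_
  have hX := hΦ.mem_of_pr_ne_zero σ hY (hσ.trans_ne one_ne_zero)
  exact ⟨hX, mem_controlPre_iff.2 ⟨σ, fun t ht => ⟨_, (hΦ.pr_eq_one_iff σ hX hY).1 hσ t ht⟩⟩⟩

theorem untilMap_quant_positive_subset (hΦ : IsExpansion X Y Φ) :
    untilMap G.existsPre X Y (G.quant .positive Φ) ⊆ G.quant .positive Φ := by
  intro s hs
  by_cases hY : s ∈ Y
  · obtain ⟨σ⟩ := G.nonempty_strategy
    exact ⟨σ, hΦ.pr_of_mem σ hY ▸ one_pos⟩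
  · obtain ⟨hX, hs⟩ := hs.resolve_left hY
    obtain ⟨σ₀, t, ht, σ, hσ⟩ := mem_existsPre_iff.1 hs
    refine ⟨σ₀.cons σ, pos_iff_ne_zero.2 ((hΦ.pr_ne_zero_iff _ hX hY).2 ⟨t, ?_, hσ.ne'⟩)⟩
    rwa [Strategy.nextState_cons]

end IsExpansion

/-- Moves after any history are also possible first moves, so the one-step operators constrain every
step of a play. -/
theorem Strategy.exists_nextState_nil_eq (σ : G.Strategy) (h : List (G.State × Option G.A))
    (s : G.State) : ∃ σ' : G.Strategy, σ'.nextState [] s = σ.nextState h s :=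
  ⟨⟨fun _ => σ.act h, fun _ => σ.act_mem h⟩, by rcases s with s | s <;> rfl⟩

/-- Weak until is a safety condition: a positional strategy whose possible successors all stay in
the greatest fixed point achieves it. -/
theorem quant_almost_weakUntil (X Y : Set G.State) :
    G.quant .almost (pathWeakUntil X Y) = (untilMap G.controlPre X Y).gfp := by
  set F := untilMap G.controlPre X Y
  have hΦ := isExpansion_pathWeakUntil X Y
  refine Set.Subset.antisymm (F.le_gfp hΦ.quant_almost_subset) fun s hs => ?_
  obtain ⟨σ, -, hσ, hσ'⟩ := G.exists_positional fun _ μ => ∀ t, μ t ≠ 0 → t ∈ F.gfp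
  refine ⟨σ, (mem_ae_iff_prob_eq_one hΦ.measurableSet).1 ?_⟩
  filter_upwards [σ.ae_start s, σ.ae_steps s (R := fun s t => σ.nextState [] s t ≠ 0)
    fun h s t ht => hσ h s ▸ ht] with ω hω₀ hω
  refine mem_pathWeakUntil_of_invariant (Z := F.gfp) (hω₀.symm ▸ hs) fun n hn => ?_
  rw [← F.map_gfp] at hn
  exact hn.imp_right fun h => ⟨h.1, hσ' _ (mem_controlPre_iff.1 h.2) _ (hω n)⟩

theorem quant_positive_until (X Y : Set G.State) :
    G.quant .positive (pathUntil X Y) = (untilMap G.existsPre X Y).lfp := by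
  set F := untilMap G.existsPre X Y
  have hΦ := isExpansion_pathUntil X Y
  refine Set.Subset.antisymm ?_ (F.lfp_le hΦ.untilMap_quant_positive_subset)
  rintro s ⟨σ, hσ⟩
  by_contra hs
  refine hσ.ne' (measure_eq_zero_iff_ae_notMem.2 ?_)
  filter_upwards [σ.ae_start s, σ.ae_steps s
    (R := fun s t => ∃ σ' : G.Strategy, σ'.nextState [] s t ≠ 0) fun h s t ht => by
      obtain ⟨σ', h'⟩ := σ.exists_nextState_nil_eq h s
      exact ⟨σ', h' ▸ ht⟩] with ω hω₀ hω
  refine notMem_pathUntil_of_invariant (Z := (F.lfp)ᶜ) (hω₀.symm ▸ hs) fun n hn => ?_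
  have hn' : ω n ∉ F F.lfp := F.map_lfp.symm ▸ hn
  refine ⟨fun h => hn' (Or.inl h), fun h h' => hn' (Or.inr ⟨h, mem_existsPre_iff.2 ?_⟩)⟩
  exact (hω n).imp fun _ ht => ⟨_, ht, h'⟩

/-- `⟨Positive⟩ (X W Y)` holds where a state at which Player 1 surely achieves `X W Y` can be
reached within `X`. -/
theorem quant_positive_weakUntil (X Y : Set G.State) :
    G.quant .positive (pathWeakUntil X Y) =
      (untilMap G.existsPre X (untilMap G.controlPre X Y).gfp).lfp := by
  have hΦ := isExpansion_pathWeakUntil X Y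
  have hgfp := quant_almost_weakUntil X Y
  set Φ := pathWeakUntil X Y
  set W := (untilMap G.controlPre X Y).gfp
  set V := (untilMap G.existsPre X W).lfp
  have hYW : Y ⊆ W := fun s hs => (untilMap G.controlPre X Y).map_gfp.subset (Or.inl hs)
  apply Set.Subset.antisymm
  -- `f` is the optimal probability of `Φ`. If it is positive somewhere outside `V`, its maximisers
  -- outside `V` will form a post-fixed point for `W`, contradicting `W ⊆ V`.
  · let f : G.State → ℝ≥0∞ := fun s => ⨆ σ : G.Strategy, σ.pr s Φ
    have hf1 : ∀ s, f s ≤ 1 := fun s => iSup_le fun σ => prob_le_one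
    rintro s ⟨σ, hσ⟩
    by_contra hs
    obtain ⟨a, ha, hmax⟩ := Set.exists_max_image Vᶜ f (Set.toFinite _) ⟨s, hs⟩
    have hpos : f a ≠ 0 := (hσ.trans_le ((le_iSup (fun σ : G.Strategy => σ.pr s Φ) σ).trans
      (hmax s hs))).ne'
    have hVW : ∀ t ∉ V, t ∉ W ∧ (t ∈ X → t ∉ G.existsPre V) := fun t ht => by
      have ht' : t ∉ untilMap G.existsPre X W V := (untilMap G.existsPre X W).map_lfp.symm ▸ ht
      exact ⟨fun h => ht' (Or.inl h), fun h h' => ht' (Or.inr ⟨h, h'⟩)⟩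
    have hM : {t | t ∉ V ∧ f t = f a} ⊆ W := by
      refine (untilMap G.controlPre X Y).le_gfp ?_
      rintro t ⟨ht, hft⟩
      obtain ⟨htW, htE⟩ := hVW t ht
      have htY : t ∉ Y := fun h => htW (hYW h)
      have htX : t ∈ X := by
        by_contra htX
        refine hpos (hft ▸ (ENNReal.iSup_eq_zero.2 fun σ => ?_))
        by_contra h
        exact htX (hΦ.mem_of_pr_ne_zero σ htY h)
      have hnext : ∀ σ : G.Strategy, ∀ u, σ.nextState [] t u ≠ 0 → u ∉ V := fun σ u hu h =>
        htE htX (mem_existsPre_iff.2 ⟨σ, u, hu, h⟩)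
      -- At a maximiser, the best first move gives an average of `f` at least `f a`, while no
      -- successor exceeds `f a`; hence every successor is again a maximiser.
      obtain ⟨_, ⟨σ₀, rfl⟩, hσ₀⟩ := Set.exists_max_image _
        (fun μ : PMF G.State => ∑' u, μ u * f u) (finite_range_nextState t)
        ⟨_, Set.mem_range_self σ⟩
      refine Or.inr ⟨htX, mem_controlPre_iff.2 ⟨σ₀, fun u hu => ⟨hnext σ₀ u hu, ?_⟩⟩⟩
      refine PMF.eq_of_le_tsum_mul _ ((hf1 a).trans_lt ENNReal.one_lt_top).ne
        (fun u hu => hmax u (hnext σ₀ u hu)) ?_ hu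
      rw [← hft]
      refine iSup_le fun σ => ?_
      rw [hΦ.pr_eq_sum σ htX htY]
      refine le_trans (ENNReal.tsum_le_tsum fun u => ?_) (hσ₀ _ (Set.mem_range_self σ))
      exact mul_le_mul_right (le_iSup (fun σ : G.Strategy => σ.pr u Φ) _) _
    exact (hVW a ha).1 (hM ⟨ha, rfl⟩)
  · refine (untilMap G.existsPre X W).lfp_le ?_
    rintro s (hs | hs)
    · obtain ⟨σ, hσ⟩ := hgfp.symm.subset hs
      exact ⟨σ, hσ ▸ one_pos⟩
    · exact hΦ.untilMap_quant_positive_subset (Or.inr hs)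

/-- The map whose greatest fixed point describes `⟨Almost⟩ (X U Y)`. -/
def almostUntilMap (pre epre : Set G.State →o Set G.State) (X Y : Set G.State) :
    Set G.State →o Set G.State where
  toFun Z := (untilMap epre (X ∩ pre Z) Y).lfp
  monotone' _ _ h := OrderHom.lfp.mono fun _ => Set.union_subset_union_right _
    (Set.inter_subset_inter_left _ (Set.inter_subset_inter_right _ (pre.mono h)))

/-- The outer greatest fixed point keeps the play where almost sure success remains possible; the
inner least one provides a path to `Y` of positive probability that can always be resumed. -/
theorem quant_almost_until (X Y : Set G.State) :
    G.quant .almost (pathUntil X Y) = (almostUntilMap G.controlPre G.existsPre X Y).gfp := by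
  have hΦ := isExpansion_pathUntil X Y
  set H := almostUntilMap G.controlPre G.existsPre X Y
  set Φ := pathUntil X Y
  apply Set.Subset.antisymm
  · refine H.le_gfp ?_
    set Z := G.quant .almost Φ
    set F := untilMap G.existsPre (X ∩ G.controlPre Z) Y
    change Z ⊆ F.lfp
    -- An almost surely winning strategy only visits `Z`, so a play starting outside `F.lfp` cannot
    -- enter it and never meets `Y`, which lies inside.
    have hnever : ∀ n, ∀ σ : G.Strategy, ∀ s ∉ F.lfp, σ.pr s Φ = 1 → ∀ᵐ ω ∂σ.pr s, ω n ∉ Y := by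
      intro n
      induction n with
      | zero =>
        intro σ s hs _
        filter_upwards [σ.ae_start s] with ω hω hY
        rw [← F.map_lfp] at hs
        exact hs (Or.inl (hω ▸ hY))
      | succ n ih =>
        intro σ s hs hσ
        refine (σ.ae_iff s (measurableSet_apply_mem (n + 1) Yᶜ)).2 fun t ht => ?_
        have hs' : s ∉ F F.lfp := F.map_lfp.symm ▸ hs
        have hY : s ∉ Y := fun h => hs' (Or.inl h)
        obtain ⟨hX, hc⟩ := (hΦ.quant_almost_subset ⟨σ, hσ⟩).resolve_left hY
        refine ih _ t (fun htF => hs' (Or.inr ⟨⟨hX, hc⟩, ?_⟩))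
          ((hΦ.pr_eq_one_iff σ hX hY).1 hσ t ht)
        exact mem_existsPre_iff.2 ⟨σ, t, ht, htF⟩
    rintro s ⟨σ, hσ⟩
    by_contra hs
    refine one_ne_zero (hσ.symm.trans (measure_eq_zero_iff_ae_notMem.2 ?_))
    filter_upwards [ae_all_iff.2 fun n => hnever n σ s hs hσ] with ω hω
    rintro ⟨j, hj, -⟩
    exact hω j hj
  · intro s hs
    set Z := H.gfp
    set F := untilMap G.existsPre (X ∩ G.controlPre Z) Y
    have hFZ : F.lfp = Z := H.map_gfp
    obtain ⟨r, hr⟩ := F.exists_rank_lfp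
    rw [hFZ] at hr
    obtain ⟨σ, hshift, -, hσ⟩ := G.exists_positional fun s μ =>
      (∀ t, μ t ≠ 0 → t ∈ Z) ∧ ∃ t, μ t ≠ 0 ∧ t ∈ Z ∧ r t < r s
    refine ⟨σ, ?_⟩
    -- Take the least success probability on `Z`, then the least rank among its minimisers. Outside
    -- `Y`, averaging would make all successors minimisers, one of them of smaller rank; so the
    -- minimum is attained in `Y`, where it is 1.
    obtain ⟨a, ha, hmin⟩ := Set.exists_min_image Z (fun s => σ.pr s Φ) (Set.toFinite _) ⟨s, hs⟩
    obtain ⟨b, ⟨hb, hba⟩, hbr⟩ := Set.exists_min_image {t | t ∈ Z ∧ σ.pr t Φ = σ.pr a Φ} r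
      (Set.toFinite _) ⟨a, ha, rfl⟩
    have hbY : b ∈ Y := by
      by_contra hbY
      obtain ⟨⟨hX, hc⟩, he⟩ := (hr b hb).resolve_left hbY
      obtain ⟨hnext, t, ht, htZ, htr⟩ := hσ b
        (exists_strategy_of_mem_controlPre_of_mem_existsPre (fun _ h => h.1) hc he)
      refine (hbr t ⟨htZ, ?_⟩).not_gt htr
      have hsum := hΦ.pr_eq_sum σ hX hbY
      rw [hshift, hba] at hsum
      exact PMF.eq_of_tsum_mul_le _ (measure_ne_top _ _) (fun u hu => hmin u (hnext u hu))
        hsum.ge ht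
    refine le_antisymm prob_le_one ?_
    rw [← hΦ.pr_of_mem σ hbY, hba]
    exact hmin s hs

/-- The proposition `turn` makes `Option AP` nonempty even if `AP` is empty, so the constants true
and false needed for characteristic formulas exist. -/
theorem qctlPreorder_eq_combinedSimulation (G : MDP.{u, v} AP) (G' : MDP.{u, w} AP) :
    G.qctlPreorder G' = Game.combinedSimulation G.twoPlayer G'.twoPlayer := by
  funext s s'
  refine propext ⟨fun h => ⟨_, Game.isCombinedSimulation_of_next (G := G.twoPlayer)
    (G' := G'.twoPlayer) (quant := G.quant) (quant' := G'.quant) .almost .positive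
    quant_almost_next quant_positive_next quant_almost_next quant_positive_next, h⟩, ?_⟩
  rintro ⟨C, hC, hs⟩ ψ
  have hc : ∀ (Z : Set G.State) (Z' : Set G'.State), Transfers C Z Z' →
      Transfers C (G.controlPre Z) (G'.controlPre Z') := hC.transfers_controlPre
  have he : ∀ (Z : Set G.State) (Z' : Set G'.State), Transfers C Z Z' →
      Transfers C (G.existsPre Z) (G'.existsPre Z') := hC.transfers_existsPre
  refine BranchingFormula.transfers_sem (S := G.State) (S' := G'.State) (C := C)
    hC.label_eq ?_ ?_ ?_ ψ s s' hs
  · rintro (_ | _) X X' hX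
    · rw [quant_almost_next, quant_almost_next]
      exact hc X X' hX
    · rw [quant_positive_next, quant_positive_next]
      exact he X X' hX
  · rintro (_ | _) X Y X' Y' hX hY
    · rw [quant_almost_until, quant_almost_until]
      exact .gfp fun Z Z' hZ => .lfp fun _ _ => .untilMap he (hX.inter (hc Z Z' hZ)) hY
    · rw [quant_positive_until, quant_positive_until]
      exact .lfp fun _ _ => .untilMap he hX hY
  · rintro (_ | _) X Y X' Y' hX hY
    · rw [quant_almost_weakUntil, quant_almost_weakUntil]
      exact .gfp fun _ _ => .untilMap hc hX hY
    · rw [quant_positive_weakUntil, quant_positive_weakUntil]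
      exact .lfp fun _ _ => .untilMap he hX (.gfp fun _ _ => .untilMap hc hX hY)

end MDP

theorem mainTheorem1 {AP : Type u} (G : MDP.{u, v} AP) (G' : MDP.{u, w} AP) :
    G.qctlPreorder G' = Game.combinedSimulation G.twoPlayer G'.twoPlayer ∧
      G.qctlPreorder G' = Game.catlPreorder G.twoPlayer G'.twoPlayer := by
  have h := G.qctlPreorder_eq_combinedSimulation G'
  exact ⟨h, h.trans (G.twoPlayer.catlPreorder_eq_combinedSimulation G'.twoPlayer).symm⟩
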